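/- Let $X$ be a closed surface (a compact Hausdorff $2$-manifold without boundary), let $T=(V,E,F)$ be a (simplicial) triangulation of $X$, and let $\Phi:E\to[0,\pi/2]$ be a weight on the edges. A circle packing metric is a positive function $r:V\to(0,\infty)$, $i\mapsto r_i$. It assigns to each edge $ij$ the hyperbolic length $l_{ij}>0$ with $$\cosh l_{ij}=\cosh r_i\cosh r_j+\sinh r_i\sinh r_j\cos\Phi_{ij},$$ and for each $\{i,j,k\}\in F$ we write $\theta_i^{jk}$ for the inner angle at $i$ of the hyperbolic triangle with side lengths $l_{ij},l_{ik},l_{jk}$. Put $$K_i=2\pi-\sum_{\{i,j,k\}\in F}\theta_i^{jk},\qquad R_i=\frac{K_i}{4\pi\sinh^2\frac{r_i}{2}},\qquad g_i=\sinh^2\frac{r_i}{2}.$$ A zero curvature metric is a circle packing metric with $R_i=0$ for all $i\in V$. The combinatorial Ricci flow is the system of ODEs for circle packing metrics $r(t)$ $$\frac{dg_i}{dt}=-R_i\,g_i\qquad(i\in V).$$ (1) Suppose that a zero curvature metric $r^*$ exists. Then for every initial circle packing metric $r(0)$ the solution $r(t)$ of the combinatorial Ricci flow exists for all $t\in[0,\infty)$,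 is unique (every solution on an interval $[0,b)$ with the same initial value is its restriction), and converges exponentially fast to $r^*$: there are constants $C,c>0$, which may depend on $r(0)$, with $|r_i(t)-r_i^*|\le Ce^{-ct}$ for all $t\ge 0$ and $i\in V$. (2) For every initial circle packing metric $r(0)$, the combinatorial Ricci flow starting at $r(0)$ converges (that is, a solution exists on $[0,\infty)$ and tends, as $t\to\infty$, to some circle packing metric) if and only if a zero curvature metric exists. -/

import Mathlib

open Filter Topology

noncomputable section

/-- The topological realization of a finite abstract simplicial complex, in barycentric
coordinates: the points of the standard simplex on the vertex set whose support is a simplex. -/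
def simplicialRealization {V : Type*} [Fintype V] (K : AbstractSimplicialComplex V) :
    Set (V → ℝ) :=
  {x | x ∈ stdSimplex ℝ V ∧ Finset.univ.filter (fun v => x v ≠ 0) ∈ K.faces}

/-- A triangulation, with vertex set `V`, of the topological space `X`: a finite simplicial
complex on `V` together with a homeomorphism of its realization onto `X`. -/
structure SurfaceTriangulation (V : Type*) [Fintype V] (X : Type*) [TopologicalSpace X] where
  complex : AbstractSimplicialComplex V
  homeo : simplicialRealization complex ≃ₜ X

namespace SurfaceTriangulation

variable {V : Type*} [Fintype V] [DecidableEq V] {X : Type*} [TopologicalSpace X]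

/-- The set `E` of edges, as unordered pairs of distinct vertices. -/
def edgeSet (T : SurfaceTriangulation V X) : Set (Sym2 V) :=
  {e | ¬ e.IsDiag ∧ e.toFinset ∈ T.complex.faces}

/-- The set `F` of triangles, as three-element sets of vertices. -/
def triangleSet (T : SurfaceTriangulation V X) : Set (Finset V) :=
  {f | f ∈ T.complex.faces ∧ f.card = 3}

/-- A weight `E → [0, π/2]`. It is carried by a function on all unordered pairs of vertices,
whose values outside `E` are irrelevant. -/
def IsWeight (T : SurfaceTriangulation V X) (Φ : Sym2 V → ℝ) : Prop :=
  ∀ e ∈ T.edgeSet, Φ e ∈ Set.Icc 0 (Real.pi / 2)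

end SurfaceTriangulation

/-- A circle packing metric is a positive function on the vertices. -/
def IsCirclePackingMetric {V : Type*} (r : V → ℝ) : Prop := ∀ i, 0 < r i

/-- The hyperbolic length `l_ij` of the edge `ij`, given by
`cosh l_ij = cosh r_i cosh r_j + sinh r_i sinh r_j cos Φ_ij`. -/
def hypEdgeLength {V : Type*} (Φ : Sym2 V → ℝ) (r : V → ℝ) (i j : V) : ℝ :=
  Real.arcosh (Real.cosh (r i) * Real.cosh (r j) +
    Real.sinh (r i) * Real.sinh (r j) * Real.cos (Φ s(i, j)))

/-- The inner angle at `v_i` of the hyperbolic triangle `v_i v_j v_k` with side lengths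
`l_ij`, `l_ik`, `l_jk`, by the hyperbolic law of cosines. -/
def hypAngle {V : Type*} (Φ : Sym2 V → ℝ) (r : V → ℝ) (i j k : V) : ℝ :=
  Real.arccos
    ((Real.cosh (hypEdgeLength Φ r i j) * Real.cosh (hypEdgeLength Φ r i k) -
        Real.cosh (hypEdgeLength Φ r j k)) /
      (Real.sinh (hypEdgeLength Φ r i j) * Real.sinh (hypEdgeLength Φ r i k)))

theorem hypEdgeLength_comm {V : Type*} (Φ : Sym2 V → ℝ) (r : V → ℝ) (i j : V) :
    hypEdgeLength Φ r i j = hypEdgeLength Φ r j i := by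
  unfold hypEdgeLength
  rw [Sym2.eq_swap, mul_comm (Real.cosh (r i)), mul_comm (Real.sinh (r i))]

theorem hypAngle_comm {V : Type*} (Φ : Sym2 V → ℝ) (r : V → ℝ) (i j k : V) :
    hypAngle Φ r i j k = hypAngle Φ r i k j := by
  unfold hypAngle
  rw [hypEdgeLength_comm Φ r j k, mul_comm (Real.cosh (hypEdgeLength Φ r i j)),
    mul_comm (Real.sinh (hypEdgeLength Φ r i j))]

namespace SurfaceTriangulation

variable {V : Type*} [Fintype V] [DecidableEq V] {X : Type*} [TopologicalSpace X]

open Classical in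
/-- The classical combinatorial Gauss curvature: `2π` minus the sum of the inner angles at `v_i`
over all triangles with vertex `v_i`. Every such triangle `{i, j, k}` occurs twice in the double
sum, as `(j, k)` and as `(k, j)`, with the same angle; hence the factor `1 / 2`. -/
def gaussCurvature (T : SurfaceTriangulation V X) (Φ : Sym2 V → ℝ) (r : V → ℝ) (i : V) : ℝ :=
  2 * Real.pi -
    (1 / 2) * ∑ j, ∑ k, if {i, j, k} ∈ T.triangleSet then hypAngle Φ r i j k else 0

/-- The modified curvature `R_i = K_i / (4π sinh² (r_i / 2))`. -/
def modifiedCurvature (T : SurfaceTriangulation V X) (Φ : Sym2 V → ℝ) (r : V → ℝ) (i : V) : ℝ :=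
  T.gaussCurvature Φ r i / (4 * Real.pi * Real.sinh (r i / 2) ^ 2)

/-- `r` is a circle packing metric with zero curvature. -/
def IsZeroCurvatureMetric (T : SurfaceTriangulation V X) (Φ : Sym2 V → ℝ) (r : V → ℝ) : Prop :=
  IsCirclePackingMetric r ∧ ∀ i, T.modifiedCurvature Φ r i = 0

/-- `r` is, on the time interval `I`, a solution of the combinatorial Ricci flow
`dg_i/dt = -R_i g_i`, where `g_i = sinh² (r_i / 2)`, through circle packing metrics
(with one-sided derivatives at end points of `I`). -/
def IsRicciFlowOn (T : SurfaceTriangulation V X) (Φ : Sym2 V → ℝ) (I : Set ℝ)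
    (r : ℝ → V → ℝ) : Prop :=
  ∀ t ∈ I, IsCirclePackingMetric (r t) ∧
    ∀ i, HasDerivWithinAt (fun s => Real.sinh (r s i / 2) ^ 2)
      (-(T.modifiedCurvature Φ (r t) i) * Real.sinh (r t i / 2) ^ 2) I t

end SurfaceTriangulation

end

/-!
The flow is studied in the coordinates `x i = cosh (r i)`, in which it reads
`dx i / dt = -K i / (2 * π)`, and compared with the zero curvature metric in the conformal
coordinates `u i = log (tanh (r i / 2))`, for which `dx i / du i = x i ^ 2 - 1`. The proof is a
maximum principle; neither a convex potential nor the topology of the surface enters.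

Three facts about a single triangle with weights in `[0, π / 2]` carry it.

* The cosine of the angle at a vertex does not increase with the conformal coordinate of either of
  the other two vertices (`edge_deriv_le`), and strictly increases when all three conformal
  coordinates grow at the same rate (`scalingRate_pos`). Both follow from polynomial identities
  whose right-hand sides have visibly nonnegative terms. Hence, if `u - u*` is maximal and
  nonnegative at the vertex `i`, then `K i - K* i` is at least a multiple of `u i - u* i`, uniformly
  on boxes (`exists_coshCurvature_growth`).
* The angle at a vertex tends to zero as the radius at that vertex tends to infinity, uniformly in
  the other radii (`le_cosAngle`). Hence `K i > 0` as soon as `r i` is large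
  (`exists_forall_coshCurvature_pos`).
* The angles of the triangle lie strictly between `0` and `π` (`abs_cosAngle_lt_one`), so that the
  vector field is continuously differentiable.

Given a zero curvature metric, the first two facts produce a box on whose boundary the field points
strictly inward (`exists_pointsInward_coshField`); therefore the solution exists for all times, is
unique and stays in the box. There the first fact makes the maximum of `|u i - u* i|` decay
exponentially (`exists_exponential_contraction`). Conversely, the velocity of a convergent solution
tends to zero along some sequence of times, so its limit has zero curvature
(`isZeroCurvatureMetric_of_tendsto`).
-/

/-! ### Barriers and ordinary differential equations -/

/-- Finitely many functions that start out nonpositive stay nonpositive if, at any time at which all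
of them are nonpositive, those that vanish have negative derivative. -/
theorem forall_nonpos_of_strict_barrier {κ : Type*} [Finite κ] {φ φ' : κ → ℝ → ℝ} {T : ℝ}
    (hc : ∀ k, ContinuousOn (φ k) (Set.Icc 0 T))
    (hd : ∀ k, ∀ t ∈ Set.Ico 0 T, HasDerivWithinAt (φ k) (φ' k t) (Set.Ici t) t)
    (h0 : ∀ k, φ k 0 ≤ 0)
    (hb : ∀ t ∈ Set.Ico 0 T, (∀ k, φ k t ≤ 0) → ∀ k, φ k t = 0 → φ' k t < 0) :
    ∀ t ∈ Set.Icc 0 T, ∀ k, φ k t ≤ 0 := by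
  suffices h : Set.Icc 0 T ⊆ {t | ∀ k, φ k t ≤ 0} from fun t ht k => h ht k
  refine IsClosed.Icc_subset_of_forall_mem_nhdsWithin ?_ h0 ?_
  · have h := (continuousOn_pi.mpr hc).preimage_isClosed_of_isClosed isClosed_Icc
      (isClosed_Iic (a := (0 : κ → ℝ)))
    rwa [Set.inter_comm] at h
  · rintro t ⟨ht, htT⟩
    change ∀ᶠ s in 𝓝[>] t, ∀ k, φ k s ≤ 0
    rw [eventually_all]
    intro k
    rcases (ht k).lt_or_eq with hlt | heq
    · have hcont : ContinuousWithinAt (φ k) (Set.Ioi t) t :=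
        (hd k t htT).continuousWithinAt.mono Set.Ioi_subset_Ici_self
      exact (hcont.eventually_lt_const hlt).mono fun s hs => hs.le
    · have hneg := hb t htT ht k heq
      have hsl := hasDerivWithinAt_iff_tendsto_slope.mp (hd k t htT)
      rw [Set.Ici_sdiff_left] at hsl
      filter_upwards [hsl.eventually_lt_const hneg, self_mem_nhdsWithin] with s hs hst
      rw [slope_def_field, heq, sub_zero] at hs
      by_contra hcon
      have := div_pos (not_le.mp hcon) (sub_pos.mpr hst)
      linarith

theorem exists_forward_solution_of_lipschitz_bounded {E : Type*} [NormedAddCommGroup E]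
    [NormedSpace ℝ E] [CompleteSpace E] {F : E → E} {K L : NNReal} (hK : LipschitzWith K F)
    (hL : ∀ x, ‖F x‖ ≤ L) (x₀ : E) :
    ∃ x : ℝ → E, x 0 = x₀ ∧ ∀ t ∈ Set.Ici (0 : ℝ),
      HasDerivWithinAt x (F (x t)) (Set.Ici 0) t := by
  -- Because the field is bounded on the whole space, the Picard-Lindelöf theorem applies on intervals
  -- of any length; the solutions on `[0, n]` are glued by uniqueness.
  have hloc : ∀ n : ℕ, ∃ α : ℝ → E, α 0 = x₀ ∧
      ∀ t ∈ Set.Icc (0 : ℝ) n, HasDerivWithinAt α (F (α t)) (Set.Icc (0 : ℝ) n) t := by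
    intro n
    have h : IsPicardLindelof (fun _ => F) (tmin := 0) (tmax := n)
        ⟨0, le_rfl, Nat.cast_nonneg n⟩ x₀ (L * n) 0 L K :=
      { lipschitzOnWith := fun _ _ => hK.lipschitzOnWith
        continuousOn := fun _ _ => continuousOn_const
        norm_le := fun _ _ x _ => hL x
        mul_max_le := by simp }
    exact h.exists_eq_forall_mem_Icc_hasDerivWithinAt₀
  choose α hα0 hα using hloc
  have hα' : ∀ (n : ℕ) (t : ℝ), t ∈ Set.Ico (0 : ℝ) n →
      HasDerivWithinAt (α n) (F (α n t)) (Set.Ici 0) t := fun n t ht =>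
    (hα n t ⟨ht.1, ht.2.le⟩).mono_of_mem_nhdsWithin
      (by
        rw [← Set.Ici_inter_Iic]
        exact inter_mem_nhdsWithin _ (Iic_mem_nhds ht.2))
  have hagree : ∀ m n : ℕ, m ≤ n → Set.EqOn (α m) (α n) (Set.Icc 0 m) := by
    intro m n hmn
    have hmn' : (m : ℝ) ≤ n := by exact_mod_cast hmn
    refine ODE_solution_unique (v := fun _ => F) (fun _ => hK)
      (fun t ht => (hα m t ht).continuousWithinAt)
      (fun t ht => (hα' m t ht).mono (Set.Ici_subset_Ici.mpr ht.1))
      (fun t ht => ((hα n t ⟨ht.1, ht.2.trans hmn'⟩).continuousWithinAt.mono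
        (Set.Icc_subset_Icc_right hmn')))
      (fun t ht => (hα' n t ⟨ht.1, ht.2.trans_le hmn'⟩).mono (Set.Ici_subset_Ici.mpr ht.1)) ?_
    rw [hα0, hα0]
  have hval : ∀ (n : ℕ) (t : ℝ), t ∈ Set.Icc (0 : ℝ) n → α ⌈t⌉₊ t = α n t := fun n t ht =>
    hagree _ _ (Nat.ceil_le.mpr ht.2) ⟨ht.1, Nat.le_ceil t⟩
  refine ⟨fun t => α ⌈t⌉₊ t, by simp [hα0], fun t ht => ?_⟩
  obtain ⟨n, hn⟩ := exists_nat_gt t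
  have hev : (fun s => α ⌈s⌉₊ s) =ᶠ[𝓝[Set.Ici 0] t] α n := by
    filter_upwards [self_mem_nhdsWithin, mem_nhdsWithin_of_mem_nhds (Iio_mem_nhds hn)]
      with s hs hsn
    exact hval n s ⟨hs, le_of_lt hsn⟩
  have := (hα' n t ⟨ht, hn⟩).congr_of_eventuallyEq hev (hval n t ⟨ht, hn.le⟩)
  simpa only [hval n t ⟨ht, hn.le⟩] using this

section Box

variable {V : Type*}

/-- The nearest-point projection onto a box. -/
def boxClamp (lo hi x : V → ℝ) : V → ℝ := fun i => max (lo i) (min (x i) (hi i))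

theorem boxClamp_mem {lo hi : V → ℝ} (h : lo ≤ hi) (x : V → ℝ) :
    boxClamp lo hi x ∈ Set.Icc lo hi :=
  ⟨fun _ => le_max_left _ _, fun i => max_le (h i) (min_le_right _ _)⟩

theorem boxClamp_of_mem {lo hi x : V → ℝ} (h : x ∈ Set.Icc lo hi) : boxClamp lo hi x = x := by
  ext i
  simp [boxClamp, h.1 i, h.2 i]

theorem lipschitzWith_boxClamp [Fintype V] (lo hi : V → ℝ) : LipschitzWith 1 (boxClamp lo hi) :=
  LipschitzWith.of_dist_le_mul fun x z => by
    rw [NNReal.coe_one, one_mul, dist_pi_le_iff dist_nonneg]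
    exact fun i => ((((LipschitzWith.id.min_const (hi i)).const_max (lo i)).dist_le_mul
      (x i) (z i)).trans_eq (by simp)).trans (dist_le_pi_dist x z i)

/-- On the boundary of the box `[lo, hi]` the vector field `F` points strictly into the box. -/
def PointsInward (F : (V → ℝ) → V → ℝ) (lo hi : V → ℝ) : Prop :=
  ∀ x ∈ Set.Icc lo hi, ∀ i, (x i = hi i → F x i < 0) ∧ (x i = lo i → 0 < F x i)

/-- A curve starting in the box stays in it. It has to follow the field only while it is in the box,
so that the statement applies to fields modified outside the box. -/
theorem PointsInward.mem_box [Fintype V] {F : (V → ℝ) → V → ℝ} {lo hi : V → ℝ}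
    (hF : PointsInward F lo hi) {x : ℝ → V → ℝ} {T : ℝ} (hc : ContinuousOn x (Set.Icc 0 T))
    (hd : ∀ t ∈ Set.Ico 0 T, x t ∈ Set.Icc lo hi → HasDerivWithinAt x (F (x t)) (Set.Ici t) t)
    (hd' : ∀ t ∈ Set.Ico 0 T, DifferentiableWithinAt ℝ x (Set.Ici t) t)
    (h0 : x 0 ∈ Set.Icc lo hi) : ∀ t ∈ Set.Icc 0 T, x t ∈ Set.Icc lo hi := by
  have key := forall_nonpos_of_strict_barrier (κ := V ⊕ V) (T := T)
    (φ := Sum.elim (fun i t => x t i - hi i) (fun i t => lo i - x t i))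
    (φ' := Sum.elim (fun i t => derivWithin x (Set.Ici t) t i)
      (fun i t => - derivWithin x (Set.Ici t) t i)) ?_ ?_ ?_ ?_
  · exact fun t ht => ⟨fun i => by simpa using key t ht (Sum.inr i),
      fun i => by simpa using key t ht (Sum.inl i)⟩
  · have := continuousOn_pi.mp hc
    rintro (i | i)
    · exact (this i).sub continuousOn_const
    · exact continuousOn_const.sub (this i)
  · have : ∀ i, ∀ t ∈ Set.Ico 0 T, HasDerivWithinAt (fun t => x t i)
        (derivWithin x (Set.Ici t) t i) (Set.Ici t) t := fun i t ht =>
      hasDerivWithinAt_pi.mp (hd' t ht).hasDerivWithinAt i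
    rintro (i | i) t ht
    · exact (this i t ht).sub_const _
    · exact (this i t ht).const_sub _
  · rintro (i | i)
    · simpa using h0.2 i
    · simpa using h0.1 i
  · intro t ht hall
    have hmem : x t ∈ Set.Icc lo hi := ⟨fun i => by simpa using hall (Sum.inr i),
      fun i => by simpa using hall (Sum.inl i)⟩
    have hder : derivWithin x (Set.Ici t) t = F (x t) :=
      (hd t ht hmem).derivWithin (uniqueDiffOn_Ici t t Set.self_mem_Ici)
    rintro (i | i) h
    · simpa [hder] using (hF _ hmem i).1 (by simpa [sub_eq_zero] using h)
    · simpa [hder] using (hF _ hmem i).2 (by simpa [sub_eq_zero, eq_comm] using h)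

/-- Global existence inside the box, obtained by solving the equation for the field
`F ∘ boxClamp lo hi`, which is bounded and globally Lipschitz. -/
theorem PointsInward.exists_solution [Fintype V] {F : (V → ℝ) → V → ℝ} {lo hi : V → ℝ}
    (hF : PointsInward F lo hi) {K : NNReal} (hK : LipschitzOnWith K F (Set.Icc lo hi))
    {x₀ : V → ℝ} (h0 : x₀ ∈ Set.Icc lo hi) :
    ∃ x : ℝ → V → ℝ, x 0 = x₀ ∧ ∀ t ∈ Set.Ici (0 : ℝ),
      x t ∈ Set.Icc lo hi ∧ HasDerivWithinAt x (F (x t)) (Set.Ici 0) t := by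
  have hle : lo ≤ hi := h0.1.trans h0.2
  have hlip : LipschitzWith (K * 1) (F ∘ boxClamp lo hi) := by
    rw [← lipschitzOnWith_univ]
    exact hK.comp (lipschitzWith_boxClamp lo hi).lipschitzOnWith fun x _ => boxClamp_mem hle x
  obtain ⟨L, hL⟩ := isCompact_Icc.exists_bound_of_continuousOn hK.continuousOn
  obtain ⟨x, hx0, hx⟩ := exists_forward_solution_of_lipschitz_bounded hlip (L := L.toNNReal)
    (fun x => (hL _ (boxClamp_mem hle x)).trans (Real.le_coe_toNNReal L)) x₀
  have hmem : ∀ T : ℝ, 0 ≤ T → x T ∈ Set.Icc lo hi := by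
    intro T hT
    refine hF.mem_box (x := x) (T := T) (fun t ht => ?_) (fun t ht htm => ?_) (fun t ht => ?_)
      (hx0 ▸ h0) T ⟨hT, le_rfl⟩
    · exact ((hx t ht.1).continuousWithinAt).mono Set.Icc_subset_Ici_self
    · have := (hx t ht.1).mono (Set.Ici_subset_Ici.mpr ht.1)
      rwa [Function.comp_apply, boxClamp_of_mem htm] at this
    · exact ((hx t ht.1).mono (Set.Ici_subset_Ici.mpr ht.1)).differentiableWithinAt
  refine ⟨x, hx0, fun t ht => ⟨hmem t ht, ?_⟩⟩
  have := hx t ht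
  rwa [Function.comp_apply, boxClamp_of_mem (hmem t ht)] at this

/-- Uniqueness needs the Lipschitz bound on the box only, and neither solution is assumed to stay in
the box. -/
theorem PointsInward.eqOn_solutions [Fintype V] {F : (V → ℝ) → V → ℝ} {lo hi : V → ℝ}
    (hF : PointsInward F lo hi) {K : NNReal} (hK : LipschitzOnWith K F (Set.Icc lo hi))
    {x z : ℝ → V → ℝ} {b : ℝ}
    (hx : ∀ t ∈ Set.Ico 0 b, HasDerivWithinAt x (F (x t)) (Set.Ico 0 b) t)
    (hz : ∀ t ∈ Set.Ico 0 b, HasDerivWithinAt z (F (z t)) (Set.Ico 0 b) t)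
    (h0 : x 0 ∈ Set.Icc lo hi) (hxz : x 0 = z 0) : Set.EqOn x z (Set.Ico 0 b) := by
  intro T hT
  have hright : ∀ {w : ℝ → V → ℝ},
      (∀ t ∈ Set.Ico 0 b, HasDerivWithinAt w (F (w t)) (Set.Ico 0 b) t) →
      ∀ t ∈ Set.Ico 0 T, HasDerivWithinAt w (F (w t)) (Set.Ici t) t := by
    intro w hw t ht
    refine ((hw t ⟨ht.1, ht.2.trans hT.2⟩).mono
      (Set.Ico_subset_Ico_left ht.1)).mono_of_mem_nhdsWithin ?_
    rw [← Set.Ici_inter_Iio]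
    exact inter_mem_nhdsWithin _ (Iio_mem_nhds (ht.2.trans hT.2))
  have hcont : ∀ {w : ℝ → V → ℝ},
      (∀ t ∈ Set.Ico 0 b, HasDerivWithinAt w (F (w t)) (Set.Ico 0 b) t) →
      ContinuousOn w (Set.Icc 0 T) := fun hw t ht =>
    (hw t ⟨ht.1, ht.2.trans_lt hT.2⟩).continuousWithinAt.mono
      (Set.Icc_subset_Ico_right hT.2)
  have hbox : ∀ {w : ℝ → V → ℝ},
      (∀ t ∈ Set.Ico 0 b, HasDerivWithinAt w (F (w t)) (Set.Ico 0 b) t) →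
      w 0 ∈ Set.Icc lo hi → ∀ t ∈ Set.Icc 0 T, w t ∈ Set.Icc lo hi := fun hw hw0 =>
    hF.mem_box (hcont hw) (fun t ht _ => hright hw t ht)
      (fun t ht => (hright hw t ht).differentiableWithinAt) hw0
  exact ODE_solution_unique_of_mem_Icc_right (v := fun _ => F) (s := fun _ => Set.Icc lo hi)
    (fun _ _ => hK) (hcont hx) (hright hx) (fun t ht => hbox hx h0 t (Set.Ico_subset_Icc_self ht))
    (hcont hz) (hright hz) (fun t ht => hbox hz (hxz ▸ h0) t (Set.Ico_subset_Icc_self ht)) hxz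
    ⟨hT.1, le_rfl⟩

end Box

/-! ### The hyperbolic triangle of three circles -/

/-- The hyperbolic cosine of the length of an edge, in terms of `x = cosh r_i`, `y = cosh r_j`
and `c = cos Φ_ij`. -/
noncomputable def coshEdge (c x y : ℝ) : ℝ := x * y + √(x ^ 2 - 1) * √(y ^ 2 - 1) * c

/-- The cosine of the angle at the first vertex of the triangle with edge weights `Φ`, in terms of
`x₁, x₂, x₃`, the hyperbolic cosines of the radii, and `c = cos Φ` for the three edges. The products
of square roots in the denominator are the hyperbolic sines of the edge lengths. -/
noncomputable def cosAngle (c₁₂ c₁₃ c₂₃ x₁ x₂ x₃ : ℝ) : ℝ :=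
  (coshEdge c₁₂ x₁ x₂ * coshEdge c₁₃ x₁ x₃ - coshEdge c₂₃ x₂ x₃) /
    (√(coshEdge c₁₂ x₁ x₂ ^ 2 - 1) * √(coshEdge c₁₃ x₁ x₃ ^ 2 - 1))

/-- The derivative of `cosAngle` in the direction in which the conformal coordinates of the three
vertices increase at unit rate, that is, `dx = x ^ 2 - 1` for each of them. The numerator has been
simplified by `dp = (x₁ + x₂) * (p - 1)`, valid for an edge with `p = coshEdge c₁₂ x₁ x₂`. -/
noncomputable def scalingRate (c₁₂ c₁₃ c₂₃ x₁ x₂ x₃ : ℝ) : ℝ :=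
  (2 * x₁ * coshEdge c₂₃ x₂ x₃ + x₂ + x₃
      - (x₁ + x₂) * (coshEdge c₂₃ x₂ x₃ + coshEdge c₁₃ x₁ x₃) / (coshEdge c₁₂ x₁ x₂ + 1)
      - (x₁ + x₃) * (coshEdge c₂₃ x₂ x₃ + coshEdge c₁₂ x₁ x₂) / (coshEdge c₁₃ x₁ x₃ + 1)) /
    (√(coshEdge c₁₂ x₁ x₂ ^ 2 - 1) * √(coshEdge c₁₃ x₁ x₃ ^ 2 - 1))

theorem sqrt_sq_sub_one_pos {x : ℝ} (hx : 1 < x) : 0 < √(x ^ 2 - 1) :=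
  Real.sqrt_pos.mpr (by nlinarith)

theorem sq_sqrt_sq_sub_one {x : ℝ} (hx : 1 < x) : x ^ 2 = 1 + √(x ^ 2 - 1) ^ 2 := by
  rw [Real.sq_sqrt (by nlinarith)]; ring

theorem mul_le_coshEdge {c : ℝ} (hc : 0 ≤ c) (x y : ℝ) : x * y ≤ coshEdge c x y := by
  unfold coshEdge
  have : 0 ≤ √(x ^ 2 - 1) * √(y ^ 2 - 1) * c := by positivity
  linarith

theorem one_lt_coshEdge {c x y : ℝ} (hc : 0 ≤ c) (hx : 1 < x) (hy : 1 < y) :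
    1 < coshEdge c x y :=
  (by nlinarith : 1 < x * y).trans_le (mul_le_coshEdge hc x y)

section Polynomial

/-! In this section `x` and `y` stand for the hyperbolic cosines and sines of the radii, and
`p`, `q`, `s` for the hyperbolic cosines of the edges `12`, `13`, `23`. -/

variable {x₁ x₂ x₃ y₁ y₂ y₃ c₁₂ c₁₃ c₂₃ p q s : ℝ}

/-- The negative of the determinant of the Gram matrix of the three vertices in the hyperboloid
model is positive: the triangle is nondegenerate. -/
theorem gram_det_pos (hx₁ : 0 < x₁) (hx₂ : 0 < x₂) (hx₃ : 0 < x₃) (hy₁ : 0 < y₁) (hy₂ : 0 < y₂)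
    (hy₃ : 0 < y₃) (h₁ : x₁ ^ 2 = 1 + y₁ ^ 2) (h₂ : x₂ ^ 2 = 1 + y₂ ^ 2)
    (h₃ : x₃ ^ 2 = 1 + y₃ ^ 2) (hc₁₂ : c₁₂ ∈ Set.Icc 0 1) (hc₁₃ : c₁₃ ∈ Set.Icc 0 1)
    (hc₂₃ : c₂₃ ∈ Set.Icc 0 1) (hp : p = x₁ * x₂ + y₁ * y₂ * c₁₂)
    (hq : q = x₁ * x₃ + y₁ * y₃ * c₁₃) (hs : s = x₂ * x₃ + y₂ * y₃ * c₂₃) :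
    0 < 1 + 2 * p * q * s - p ^ 2 - q ^ 2 - s ^ 2 := by
  obtain ⟨h12, h12'⟩ := hc₁₂
  obtain ⟨h13, h13'⟩ := hc₁₃
  obtain ⟨h23, h23'⟩ := hc₂₃
  have e12 : 0 ≤ 1 - c₁₂ ^ 2 := by nlinarith
  have e13 : 0 ≤ 1 - c₁₃ ^ 2 := by nlinarith
  have e23 : 0 ≤ 1 - c₂₃ ^ 2 := by nlinarith
  have key : 1 + 2 * p * q * s - p ^ 2 - q ^ 2 - s ^ 2
      = (1 - c₁₂ ^ 2) * (y₁ ^ 2 * y₂ ^ 2) + (1 - c₁₃ ^ 2) * (y₁ ^ 2 * y₃ ^ 2)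
        + (1 - c₂₃ ^ 2) * (y₂ ^ 2 * y₃ ^ 2)
        + 2 * y₁ ^ 2 * y₂ ^ 2 * y₃ ^ 2 * (1 + c₁₂ * c₁₃ * c₂₃)
        + 2 * x₂ * x₃ * y₁ ^ 2 * y₂ * y₃ * (c₂₃ + c₁₂ * c₁₃)
        + 2 * x₁ * x₃ * y₁ * y₂ ^ 2 * y₃ * (c₁₃ + c₁₂ * c₂₃)
        + 2 * x₁ * x₂ * y₁ * y₂ * y₃ ^ 2 * (c₁₂ + c₁₃ * c₂₃) := by
    subst hp hq hs
    grind
  rw [key]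
  positivity

/-- The numerator of the derivative of the cosine of the angle at the first vertex with respect to
the conformal coordinate of the second one is nonpositive. -/
theorem edge_deriv_le (hx₁ : 0 < x₁) (hx₂ : 0 < x₂) (hx₃ : 0 < x₃) (hy₁ : 0 < y₁) (hy₂ : 0 < y₂)
    (hy₃ : 0 < y₃) (h₁ : x₁ ^ 2 = 1 + y₁ ^ 2) (h₂ : x₂ ^ 2 = 1 + y₂ ^ 2)
    (hc₁₂ : c₁₂ ∈ Set.Icc 0 1) (hc₁₃ : 0 ≤ c₁₃)
    (hc₂₃ : 0 ≤ c₂₃) (hp : p = x₁ * x₂ + y₁ * y₂ * c₁₂)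
    (hq : q = x₁ * x₃ + y₁ * y₃ * c₁₃) (hs : s = x₂ * x₃ + y₂ * y₃ * c₂₃) :
    (y₂ ^ 2 * x₁ + x₂ * y₁ * y₂ * c₁₂) * (p * s - q)
      ≤ (y₂ ^ 2 * x₃ + x₂ * y₂ * y₃ * c₂₃) * (p ^ 2 - 1) := by
  obtain ⟨h12, h12'⟩ := hc₁₂
  have e12 : 0 ≤ 1 - c₁₂ ^ 2 := by nlinarith
  have key : (y₂ ^ 2 * x₃ + x₂ * y₂ * y₃ * c₂₃) * (p ^ 2 - 1)
      - (y₂ ^ 2 * x₁ + x₂ * y₁ * y₂ * c₁₂) * (p * s - q)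
      = y₁ * y₂ * ((1 - c₁₂ ^ 2) * (y₁ * y₂ * x₃) + (c₂₃ + c₁₂ * c₁₃) * (x₂ * y₁ * y₃)
        + (c₁₃ + c₁₂ * c₂₃) * (x₁ * y₂ * y₃)) := by
    subst hp hq hs
    grind
  rw [← sub_nonneg, key]
  positivity

/-- The numerator of `scalingRate`, over the common denominator `(p + 1) * (q + 1)`, is positive. -/
theorem scaling_numerator_pos (hx₁ : 0 < x₁) (hx₂ : 0 < x₂) (hx₃ : 0 < x₃) (hy₁ : 0 < y₁)
    (hy₂ : 0 < y₂)
    (hy₃ : 0 < y₃) (h₁ : x₁ ^ 2 = 1 + y₁ ^ 2) (h₂ : x₂ ^ 2 = 1 + y₂ ^ 2)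
    (h₃ : x₃ ^ 2 = 1 + y₃ ^ 2) (hc₁₂ : c₁₂ ∈ Set.Icc 0 1) (hc₁₃ : c₁₃ ∈ Set.Icc 0 1)
    (hc₂₃ : c₂₃ ∈ Set.Icc 0 1) (hp : p = x₁ * x₂ + y₁ * y₂ * c₁₂)
    (hq : q = x₁ * x₃ + y₁ * y₃ * c₁₃) (hs : s = x₂ * x₃ + y₂ * y₃ * c₂₃) :
    0 < (2 * x₁ * s + x₂ + x₃) * (p + 1) * (q + 1) - (x₁ + x₂) * (s + q) * (q + 1)
      - (x₁ + x₃) * (s + p) * (p + 1) := by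
  obtain ⟨h12, h12'⟩ := hc₁₂
  obtain ⟨h13, h13'⟩ := hc₁₃
  obtain ⟨h23, h23'⟩ := hc₂₃
  have e12 : 0 ≤ 1 - c₁₂ ^ 2 := by nlinarith
  have e13 : 0 ≤ 1 - c₁₃ ^ 2 := by nlinarith
  have key : (2 * x₁ * s + x₂ + x₃) * (p + 1) * (q + 1) - (x₁ + x₂) * (s + q) * (q + 1)
      - (x₁ + x₃) * (s + p) * (p + 1)
      = y₁ * ((1 - c₁₂ ^ 2) * ((x₁ + x₃) * y₁ * y₂ ^ 2)
        + (1 - c₁₃ ^ 2) * ((x₁ + x₂) * y₁ * y₃ ^ 2)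
        + 2 * x₁ * y₁ * y₂ ^ 2 * y₃ ^ 2 * (1 + c₁₂ * c₁₃ * c₂₃)
        + (c₂₃ + c₁₂ * c₁₃) * (x₃ + x₂ + 2 * x₁ * x₂ * x₃) * y₁ * y₂ * y₃
        + (c₁₃ + c₁₂ * c₂₃) * (x₃ + 2 * x₃ * y₁ ^ 2 + x₁) * y₂ ^ 2 * y₃
        + (c₁₂ + c₁₃ * c₂₃) * (x₂ + 2 * x₂ * y₁ ^ 2 + x₁) * y₂ * y₃ ^ 2) := by
    subst hp hq hs
    grind
  rw [key]
  positivity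

end Polynomial

section Triangle

variable {c₁₂ c₁₃ c₂₃ x₁ x₂ x₃ : ℝ}

theorem scalingRate_pos (hc₁₂ : c₁₂ ∈ Set.Icc 0 1) (hc₁₃ : c₁₃ ∈ Set.Icc 0 1)
    (hc₂₃ : c₂₃ ∈ Set.Icc 0 1) (hx₁ : 1 < x₁) (hx₂ : 1 < x₂) (hx₃ : 1 < x₃) :
    0 < scalingRate c₁₂ c₁₃ c₂₃ x₁ x₂ x₃ := by
  have hp := one_lt_coshEdge hc₁₂.1 hx₁ hx₂
  have hq := one_lt_coshEdge hc₁₃.1 hx₁ hx₃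
  have key := scaling_numerator_pos (zero_lt_one.trans hx₁) (zero_lt_one.trans hx₂)
    (zero_lt_one.trans hx₃) (sqrt_sq_sub_one_pos hx₁) (sqrt_sq_sub_one_pos hx₂)
    (sqrt_sq_sub_one_pos hx₃) (sq_sqrt_sq_sub_one hx₁) (sq_sqrt_sq_sub_one hx₂)
    (sq_sqrt_sq_sub_one hx₃) hc₁₂ hc₁₃ hc₂₃ (p := coshEdge c₁₂ x₁ x₂) (q := coshEdge c₁₃ x₁ x₃)
    (s := coshEdge c₂₃ x₂ x₃) rfl rfl rfl
  unfold scalingRate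
  set p := coshEdge c₁₂ x₁ x₂
  set q := coshEdge c₁₃ x₁ x₃
  set s := coshEdge c₂₃ x₂ x₃
  refine div_pos ?_ (mul_pos (sqrt_sq_sub_one_pos hp) (sqrt_sq_sub_one_pos hq))
  have hp0 : 0 < p + 1 := by linarith
  have hq0 : 0 < q + 1 := by linarith
  have h : 2 * x₁ * s + x₂ + x₃ - (x₁ + x₂) * (s + q) / (p + 1) - (x₁ + x₃) * (s + p) / (q + 1)
      = ((2 * x₁ * s + x₂ + x₃) * (p + 1) * (q + 1) - (x₁ + x₂) * (s + q) * (q + 1)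
      - (x₁ + x₃) * (s + p) * (p + 1)) / ((p + 1) * (q + 1)) := by
    field_simp
  rw [h]
  positivity

theorem abs_cosAngle_lt_one (hc₁₂ : c₁₂ ∈ Set.Icc 0 1) (hc₁₃ : c₁₃ ∈ Set.Icc 0 1)
    (hc₂₃ : c₂₃ ∈ Set.Icc 0 1) (hx₁ : 1 < x₁) (hx₂ : 1 < x₂) (hx₃ : 1 < x₃) :
    |cosAngle c₁₂ c₁₃ c₂₃ x₁ x₂ x₃| < 1 := by
  have hp := one_lt_coshEdge hc₁₂.1 hx₁ hx₂
  have hq := one_lt_coshEdge hc₁₃.1 hx₁ hx₃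
  have key := gram_det_pos (zero_lt_one.trans hx₁) (zero_lt_one.trans hx₂)
    (zero_lt_one.trans hx₃) (sqrt_sq_sub_one_pos hx₁) (sqrt_sq_sub_one_pos hx₂)
    (sqrt_sq_sub_one_pos hx₃) (sq_sqrt_sq_sub_one hx₁) (sq_sqrt_sq_sub_one hx₂)
    (sq_sqrt_sq_sub_one hx₃) hc₁₂ hc₁₃ hc₂₃ (p := coshEdge c₁₂ x₁ x₂) (q := coshEdge c₁₃ x₁ x₃)
    (s := coshEdge c₂₃ x₂ x₃) rfl rfl rfl
  unfold cosAngle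
  set p := coshEdge c₁₂ x₁ x₂
  set q := coshEdge c₁₃ x₁ x₃
  set s := coshEdge c₂₃ x₂ x₃
  have hd := mul_pos (sqrt_sq_sub_one_pos hp) (sqrt_sq_sub_one_pos hq)
  rw [abs_div, abs_of_pos hd, div_lt_one hd]
  refine abs_lt_of_sq_lt_sq ?_ hd.le
  rw [mul_pow, Real.sq_sqrt (by nlinarith), Real.sq_sqrt (by nlinarith)]
  linarith

/-- A lower bound of the cosine of the angle at the first vertex that does not depend on the other
two radii and tends to `1` as the first radius tends to infinity. -/
theorem le_cosAngle (hc₁₂ : 0 ≤ c₁₂) (hc₁₃ : 0 ≤ c₁₃)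
    (hc₂₃ : c₂₃ ≤ 1) (hx₁ : 1 < x₁) (hx₂ : 1 < x₂) (hx₃ : 1 < x₃) :
    1 - 2 / (x₁ ^ 2 - 1) ≤ cosAngle c₁₂ c₁₃ c₂₃ x₁ x₂ x₃ := by
  have hp := one_lt_coshEdge hc₁₂ hx₁ hx₂
  have hq := one_lt_coshEdge hc₁₃ hx₁ hx₃
  have hp' := mul_le_coshEdge hc₁₂ x₁ x₂
  have hq' := mul_le_coshEdge hc₁₃ x₁ x₃
  have hs' : coshEdge c₂₃ x₂ x₃ ≤ 2 * (x₂ * x₃) := by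
    unfold coshEdge
    have h2 : √(x₂ ^ 2 - 1) ≤ x₂ := Real.sqrt_le_iff.mpr ⟨by linarith, by linarith⟩
    have h3 : √(x₃ ^ 2 - 1) ≤ x₃ := Real.sqrt_le_iff.mpr ⟨by linarith, by linarith⟩
    have h23 : √(x₂ ^ 2 - 1) * √(x₃ ^ 2 - 1) ≤ x₂ * x₃ :=
      mul_le_mul h2 h3 (Real.sqrt_nonneg _) (by linarith)
    have := mul_le_mul_of_nonneg_left hc₂₃
      (mul_nonneg (Real.sqrt_nonneg (x₂ ^ 2 - 1)) (Real.sqrt_nonneg (x₃ ^ 2 - 1)))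
    linarith
  unfold cosAngle
  set p := coshEdge c₁₂ x₁ x₂
  set q := coshEdge c₁₃ x₁ x₃
  set s := coshEdge c₂₃ x₂ x₃
  have hd := mul_pos (sqrt_sq_sub_one_pos hp) (sqrt_sq_sub_one_pos hq)
  have hy : 0 < x₁ ^ 2 - 1 := by nlinarith
  have bound : ∀ {P x : ℝ}, 1 < x → x₁ * x ≤ P → √(x₁ ^ 2 - 1) * x ≤ √(P ^ 2 - 1) := by
    intro P x hx hP
    refine Real.le_sqrt_of_sq_le ?_
    rw [mul_pow, Real.sq_sqrt hy.le]
    have : (x₁ * x) ^ 2 ≤ P ^ 2 := by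
      have : 0 ≤ x₁ * x := by positivity
      gcongr
    nlinarith
  have hD : (x₁ ^ 2 - 1) * (x₂ * x₃) ≤ √(p ^ 2 - 1) * √(q ^ 2 - 1) := by
    calc (x₁ ^ 2 - 1) * (x₂ * x₃) = (√(x₁ ^ 2 - 1) * x₂) * (√(x₁ ^ 2 - 1) * x₃) := by
          rw [mul_mul_mul_comm, Real.mul_self_sqrt hy.le]
      _ ≤ _ := mul_le_mul (bound hx₂ hp') (bound hx₃ hq') (by positivity) (Real.sqrt_nonneg _)
  -- the Cauchy–Schwarz bound `sinh a * sinh b ≤ cosh a * cosh b - 1`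
  have hD' : √(p ^ 2 - 1) * √(q ^ 2 - 1) ≤ p * q - 1 := by
    rw [← Real.sqrt_mul (by nlinarith)]
    refine Real.sqrt_le_iff.mpr ⟨by nlinarith, by nlinarith [sq_nonneg (p - q)]⟩
  rw [le_div_iff₀ hd, sub_mul, one_mul]
  have h1 : 2 * (x₂ * x₃) ≤ 2 / (x₁ ^ 2 - 1) * (√(p ^ 2 - 1) * √(q ^ 2 - 1)) := by
    rw [div_mul_eq_mul_div, le_div_iff₀ hy]
    linarith
  linarith

end Triangle

/-! ### The derivative of the angle -/

section Derivative

theorem hasDerivAt_sqrt_sq_sub_one {X : ℝ → ℝ} {X' t : ℝ} (h : HasDerivAt X X' t)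
    (hX : 1 < X t) :
    HasDerivAt (fun t => √(X t ^ 2 - 1)) (X t * X' / √(X t ^ 2 - 1)) t := by
  have := ((h.pow 2).sub_const 1).sqrt (by nlinarith : X t ^ 2 - 1 ≠ 0)
  convert! this using 1
  have := (sqrt_sq_sub_one_pos hX).ne'
  norm_num
  field_simp

theorem hasDerivAt_coshEdge {X Y : ℝ → ℝ} {v w t : ℝ} (c : ℝ)
    (hX : HasDerivAt X (v * (X t ^ 2 - 1)) t) (hY : HasDerivAt Y (w * (Y t ^ 2 - 1)) t)
    (hX1 : 1 < X t) (hY1 : 1 < Y t) :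
    HasDerivAt (fun t => coshEdge c (X t) (Y t))
      (v * (√(X t ^ 2 - 1) ^ 2 * Y t + X t * √(X t ^ 2 - 1) * √(Y t ^ 2 - 1) * c) +
        w * (√(Y t ^ 2 - 1) ^ 2 * X t + Y t * √(X t ^ 2 - 1) * √(Y t ^ 2 - 1) * c)) t := by
  have h := (hX.mul hY).add (((hasDerivAt_sqrt_sq_sub_one hX hX1).mul
    (hasDerivAt_sqrt_sq_sub_one hY hY1)).mul_const c)
  convert! h using 1
  have h1 := (sqrt_sq_sub_one_pos hX1).ne'
  have h2 := (sqrt_sq_sub_one_pos hY1).ne'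
  have e1 : X t ^ 2 - 1 = √(X t ^ 2 - 1) ^ 2 := by linarith [sq_sqrt_sq_sub_one hX1]
  have e2 : Y t ^ 2 - 1 = √(Y t ^ 2 - 1) ^ 2 := by linarith [sq_sqrt_sq_sub_one hY1]
  generalize √(X t ^ 2 - 1) = a at *
  generalize √(Y t ^ 2 - 1) = b at *
  rw [e1, e2]
  field_simp
  ring

theorem hasDerivAt_cosine_law {P Q S : ℝ → ℝ} {P' Q' S' t : ℝ} (hP : HasDerivAt P P' t)
    (hQ : HasDerivAt Q Q' t) (hS : HasDerivAt S S' t) (hP1 : 1 < P t) (hQ1 : 1 < Q t) :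
    HasDerivAt (fun t => (P t * Q t - S t) / (√(P t ^ 2 - 1) * √(Q t ^ 2 - 1)))
      ((P' * (P t * S t - Q t) / (P t ^ 2 - 1) + Q' * (Q t * S t - P t) / (Q t ^ 2 - 1) - S') /
        (√(P t ^ 2 - 1) * √(Q t ^ 2 - 1))) t := by
  have h1 := (sqrt_sq_sub_one_pos hP1).ne'
  have h2 := (sqrt_sq_sub_one_pos hQ1).ne'
  have h := ((hP.mul hQ).sub hS).div ((hasDerivAt_sqrt_sq_sub_one hP hP1).mul
    (hasDerivAt_sqrt_sq_sub_one hQ hQ1)) (mul_ne_zero h1 h2)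
  convert! h using 1
  have e1 : P t ^ 2 - 1 = √(P t ^ 2 - 1) ^ 2 := by linarith [sq_sqrt_sq_sub_one hP1]
  have e2 : Q t ^ 2 - 1 = √(Q t ^ 2 - 1) ^ 2 := by linarith [sq_sqrt_sq_sub_one hQ1]
  simp only [Pi.mul_apply, Pi.sub_apply]
  generalize √(P t ^ 2 - 1) = a at *
  generalize √(Q t ^ 2 - 1) = b at *
  rw [e1, e2]
  have e1' : P t ^ 2 = 1 + a ^ 2 := by linarith
  have e2' : Q t ^ 2 = 1 + b ^ 2 := by linarith
  generalize P t = p at *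
  generalize Q t = q at *
  generalize S t = s at *
  field_simp
  grind

/-- Let the conformal coordinates of the vertices move with velocities `v₁, v₂, v₃`. If `v₁` is the
largest, then replacing `v₂` and `v₃` by `v₁` does not increase the derivative of the cosine of the
angle at the first vertex. -/
theorem exists_hasDerivAt_cosAngle {X₁ X₂ X₃ : ℝ → ℝ} {v₁ v₂ v₃ t c₁₂ c₁₃ c₂₃ : ℝ}
    (hc₁₂ : c₁₂ ∈ Set.Icc 0 1) (hc₁₃ : c₁₃ ∈ Set.Icc 0 1) (hc₂₃ : c₂₃ ∈ Set.Icc 0 1)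
    (h₁ : HasDerivAt X₁ (v₁ * (X₁ t ^ 2 - 1)) t) (h₂ : HasDerivAt X₂ (v₂ * (X₂ t ^ 2 - 1)) t)
    (h₃ : HasDerivAt X₃ (v₃ * (X₃ t ^ 2 - 1)) t)
    (hx₁ : 1 < X₁ t) (hx₂ : 1 < X₂ t) (hx₃ : 1 < X₃ t) (hv₂ : v₂ ≤ v₁) (hv₃ : v₃ ≤ v₁) :
    ∃ d, HasDerivAt (fun t => cosAngle c₁₂ c₁₃ c₂₃ (X₁ t) (X₂ t) (X₃ t)) d t ∧
      v₁ * scalingRate c₁₂ c₁₃ c₂₃ (X₁ t) (X₂ t) (X₃ t) ≤ d := by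
  have hp := one_lt_coshEdge hc₁₂.1 hx₁ hx₂
  have hq := one_lt_coshEdge hc₁₃.1 hx₁ hx₃
  refine ⟨_, hasDerivAt_cosine_law (hasDerivAt_coshEdge c₁₂ h₁ h₂ hx₁ hx₂)
    (hasDerivAt_coshEdge c₁₃ h₁ h₃ hx₁ hx₃) (hasDerivAt_coshEdge c₂₃ h₂ h₃ hx₂ hx₃) hp hq, ?_⟩
  unfold scalingRate
  rw [← mul_div_assoc]
  refine (div_le_div_iff_of_pos_right
    (mul_pos (sqrt_sq_sub_one_pos hp) (sqrt_sq_sub_one_pos hq))).mpr ?_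
  have k1 := zero_lt_one.trans hx₁
  have k2 := zero_lt_one.trans hx₂
  have k3 := zero_lt_one.trans hx₃
  have y1 := sqrt_sq_sub_one_pos hx₁
  have y2 := sqrt_sq_sub_one_pos hx₂
  have y3 := sqrt_sq_sub_one_pos hx₃
  have e1 := sq_sqrt_sq_sub_one hx₁
  have e2 := sq_sqrt_sq_sub_one hx₂
  have e3 := sq_sqrt_sq_sub_one hx₃
  have dp : coshEdge c₁₂ (X₁ t) (X₂ t)
    = X₁ t * X₂ t + √(X₁ t ^ 2 - 1) * √(X₂ t ^ 2 - 1) * c₁₂ := rfl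
  have dq : coshEdge c₁₃ (X₁ t) (X₃ t)
    = X₁ t * X₃ t + √(X₁ t ^ 2 - 1) * √(X₃ t ^ 2 - 1) * c₁₃ := rfl
  have ds : coshEdge c₂₃ (X₂ t) (X₃ t)
    = X₂ t * X₃ t + √(X₂ t ^ 2 - 1) * √(X₃ t ^ 2 - 1) * c₂₃ := rfl
  generalize coshEdge c₁₂ (X₁ t) (X₂ t) = p at *
  generalize coshEdge c₁₃ (X₁ t) (X₃ t) = q at *
  generalize coshEdge c₂₃ (X₂ t) (X₃ t) = s at *
  generalize √(X₁ t ^ 2 - 1) = a at *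
  generalize √(X₂ t ^ 2 - 1) = b at *
  generalize √(X₃ t ^ 2 - 1) = d at *
  have m2 := edge_deriv_le k1 k2 k3 y1 y2 y3 e1 e2 hc₁₂ hc₁₃.1 hc₂₃.1 dp dq ds
  have m3 := edge_deriv_le k1 k3 k2 y1 y3 y2 e1 e3 hc₁₃ hc₁₂.1 hc₂₃.1 dq dp
    (by rw [ds]; ring : s = _)
  have hp1 : 0 < p ^ 2 - 1 := by nlinarith
  have hq1 : 0 < q ^ 2 - 1 := by nlinarith
  rw [← div_le_iff₀ hp1] at m2
  rw [← div_le_iff₀ hq1] at m3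
  have n2 := mul_le_mul_of_nonneg_left m2 (sub_nonneg.mpr hv₂)
  have n3 := mul_le_mul_of_nonneg_left m3 (sub_nonneg.mpr hv₃)
  -- along the scaling direction an edge satisfies `dp = (x₁ + x₂) * (p - 1)`
  have sp : a ^ 2 * X₂ t + X₁ t * a * b * c₁₂ = (X₁ t + X₂ t) * (p - 1)
      - (b ^ 2 * X₁ t + X₂ t * a * b * c₁₂) := by
    rw [dp]; linear_combination -X₂ t * e1 - X₁ t * e2
  have sq : a ^ 2 * X₃ t + X₁ t * a * d * c₁₃ = (X₁ t + X₃ t) * (q - 1)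
      - (d ^ 2 * X₁ t + X₃ t * a * d * c₁₃) := by
    rw [dq]; linear_combination -X₃ t * e1 - X₁ t * e3
  have ss : b ^ 2 * X₃ t + X₂ t * b * d * c₂₃ = (X₂ t + X₃ t) * (s - 1)
      - (d ^ 2 * X₂ t + X₃ t * b * d * c₂₃) := by
    rw [ds]; linear_combination -X₃ t * e2 - X₂ t * e3
  have fp : (p - 1) * ((p * s - q) / (p ^ 2 - 1)) = s - (s + q) / (p + 1) := by
    have hp0 : p + 1 ≠ 0 := by linarith
    field_simp
    ring
  have fq : (q - 1) * ((q * s - p) / (q ^ 2 - 1)) = s - (s + p) / (q + 1) := by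
    have hq0 : q + 1 ≠ 0 := by linarith
    field_simp
    ring
  rw [sp, sq]
  simp only [mul_div_assoc] at n2 n3 ⊢
  linear_combination n2 + n3 - v₁ * (X₁ t + X₂ t) * fp - v₁ * (X₁ t + X₃ t) * fq + v₁ * ss

end Derivative

/-! ### The conformal coordinate -/

section ConformalCoordinate

/-- The conformal coordinate `log (tanh (r / 2))` of the radius `r`, in terms of `x = cosh r`. It is
negative for `x > 1`. -/
noncomputable def conformalCoord (x : ℝ) : ℝ := Real.log ((x - 1) / (x + 1)) / 2

/-- The inverse of `conformalCoord`, for negative `u`: the hyperbolic cosine of the radius. -/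
noncomputable def coshOfConformal (u : ℝ) : ℝ := (1 + Real.exp (2 * u)) / (1 - Real.exp (2 * u))

theorem exp_two_mul_conformalCoord {x : ℝ} (hx : 1 < x) :
    Real.exp (2 * conformalCoord x) = (x - 1) / (x + 1) := by
  have : 0 < (x - 1) / (x + 1) := div_pos (by linarith) (by linarith)
  rw [conformalCoord, mul_div_cancel₀ _ two_ne_zero, Real.exp_log this]

theorem coshOfConformal_conformalCoord {x : ℝ} (hx : 1 < x) :
    coshOfConformal (conformalCoord x) = x := by
  have : x + 1 ≠ 0 := by linarith
  rw [coshOfConformal, exp_two_mul_conformalCoord hx]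
  have h2 : 1 - (x - 1) / (x + 1) = 2 / (x + 1) := by field_simp; ring
  rw [h2]
  field_simp
  ring

theorem conformalCoord_neg {x : ℝ} (hx : 1 < x) : conformalCoord x < 0 := by
  have h : Real.exp (2 * conformalCoord x) < 1 := by
    rw [exp_two_mul_conformalCoord hx, div_lt_one (by linarith)]
    linarith
  have := Real.exp_lt_one_iff.mp h
  linarith

theorem exp_two_mul_lt_one {u : ℝ} (hu : u < 0) : Real.exp (2 * u) < 1 :=
  Real.exp_lt_one_iff.mpr (by linarith)

theorem one_lt_coshOfConformal {u : ℝ} (hu : u < 0) : 1 < coshOfConformal u := by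
  have h := exp_two_mul_lt_one hu
  rw [coshOfConformal, one_lt_div (by linarith)]
  linarith [Real.exp_pos (2 * u)]

theorem conformalCoord_coshOfConformal {u : ℝ} (hu : u < 0) :
    conformalCoord (coshOfConformal u) = u := by
  have h := exp_two_mul_lt_one hu
  have h1 : 1 - Real.exp (2 * u) ≠ 0 := by linarith
  have e : (coshOfConformal u - 1) / (coshOfConformal u + 1) = Real.exp (2 * u) := by
    have h2 : coshOfConformal u - 1 = 2 * Real.exp (2 * u) / (1 - Real.exp (2 * u)) := by
      rw [coshOfConformal]; field_simp; ring
    have h3 : coshOfConformal u + 1 = 2 / (1 - Real.exp (2 * u)) := by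
      rw [coshOfConformal]; field_simp; ring
    rw [h2, h3]
    field_simp
  rw [conformalCoord, e, Real.log_exp]
  ring

theorem hasDerivAt_coshOfConformal {u : ℝ} (hu : u < 0) :
    HasDerivAt coshOfConformal (coshOfConformal u ^ 2 - 1) u := by
  have h := exp_two_mul_lt_one hu
  have h1 : 1 - Real.exp (2 * u) ≠ 0 := by linarith
  have he : HasDerivAt (fun u : ℝ => Real.exp (2 * u)) (Real.exp (2 * u) * 2) u := by
    simpa using ((hasDerivAt_id u).const_mul 2).exp
  have hd := (he.const_add 1).div (he.const_sub 1) h1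
  convert! hd using 1
  unfold coshOfConformal
  field_simp
  ring

theorem hasDerivAt_conformalCoord {x : ℝ} (hx : 1 < x) :
    HasDerivAt conformalCoord (1 / (x ^ 2 - 1)) x := by
  have h1 : x - 1 ≠ 0 := by linarith
  have h2 : x + 1 ≠ 0 := by linarith
  have h3 : x ^ 2 - 1 ≠ 0 := by nlinarith
  have hd := ((((hasDerivAt_id x).sub_const 1).div ((hasDerivAt_id x).add_const 1) h2).log
    (div_ne_zero h1 h2)).div_const 2
  convert! hd using 1
  simp only [id, Pi.div_apply]
  field_simp
  ring

theorem conformalCoord_le_conformalCoord {x y : ℝ} (hx : 1 < x) (hxy : x ≤ y) :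
    conformalCoord x ≤ conformalCoord y := by
  have : Real.exp (2 * conformalCoord x) ≤ Real.exp (2 * conformalCoord y) := by
    rw [exp_two_mul_conformalCoord hx, exp_two_mul_conformalCoord (hx.trans_le hxy),
      div_le_div_iff₀ (by linarith) (by linarith)]
    linarith
  linarith [Real.exp_le_exp.mp this]

theorem coshOfConformal_le_coshOfConformal {u v : ℝ} (huv : u ≤ v) (hv : v < 0) :
    coshOfConformal u ≤ coshOfConformal v := by
  have h := exp_two_mul_lt_one hv
  have h' : Real.exp (2 * u) ≤ Real.exp (2 * v) := Real.exp_le_exp.mpr (by linarith)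
  unfold coshOfConformal
  rw [div_le_div_iff₀ (by linarith) (by linarith)]
  linarith

theorem hasDerivAt_arcosh_coshOfConformal {u : ℝ} (hu : u < 0) :
    HasDerivAt (fun u => Real.arcosh (coshOfConformal u)) √(coshOfConformal u ^ 2 - 1) u := by
  have h1 := one_lt_coshOfConformal hu
  have h := (Real.hasDerivAt_arcosh (Set.mem_Ioi.mpr h1)).comp u (hasDerivAt_coshOfConformal hu)
  convert! h using 1
  have e : coshOfConformal u ^ 2 - 1 = √(coshOfConformal u ^ 2 - 1) ^ 2 := by
    linarith [sq_sqrt_sq_sub_one h1]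
  have := (sqrt_sq_sub_one_pos h1).ne'
  nth_rewrite 3 [e]
  field_simp

theorem abs_arcosh_sub_arcosh_le {M x y : ℝ} (hx : 1 < x) (hy : 1 < y) (hxM : x ≤ M)
    (hyM : y ≤ M) : |Real.arcosh x - Real.arcosh y| ≤
      √(M ^ 2 - 1) * |conformalCoord x - conformalCoord y| := by
  have hM : 1 < M := hx.trans_le hxM
  have hle : ∀ {z : ℝ}, 1 < z → z ≤ M → conformalCoord z ∈ Set.Iic (conformalCoord M) :=
    fun hz hzM => conformalCoord_le_conformalCoord hz hzM
  have := (convex_Iic (conformalCoord M)).norm_image_sub_le_of_norm_hasDerivWithin_le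
    (f := fun u => Real.arcosh (coshOfConformal u)) (C := √(M ^ 2 - 1))
    (fun u hu => (hasDerivAt_arcosh_coshOfConformal
      (lt_of_le_of_lt hu (conformalCoord_neg hM))).hasDerivWithinAt)
    (fun u hu => by
      have hu0 : u < 0 := lt_of_le_of_lt hu (conformalCoord_neg hM)
      have h1 := one_lt_coshOfConformal hu0
      have h2 := coshOfConformal_le_coshOfConformal hu (conformalCoord_neg hM)
      rw [coshOfConformal_conformalCoord hM] at h2
      rw [Real.norm_eq_abs, abs_of_nonneg (Real.sqrt_nonneg _)]
      exact Real.sqrt_le_sqrt (by nlinarith))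
    (hle hy hyM) (hle hx hxM)
  rwa [coshOfConformal_conformalCoord hx, coshOfConformal_conformalCoord hy] at this

end ConformalCoordinate

/-! ### Growth of the angle along segments in the conformal coordinates -/

theorem continuous_coshEdge : Continuous fun a : ℝ × ℝ × ℝ => coshEdge a.1 a.2.1 a.2.2 := by
  unfold coshEdge
  fun_prop

theorem exists_scalingRate_lower_bound {m M : ℝ} (hm : 1 < m) (hmM : m ≤ M) :
    ∃ δ > 0, ∀ c₁₂ ∈ Set.Icc (0 : ℝ) 1, ∀ c₁₃ ∈ Set.Icc (0 : ℝ) 1, ∀ c₂₃ ∈ Set.Icc (0 : ℝ) 1,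
      ∀ x₁ ∈ Set.Icc m M, ∀ x₂ ∈ Set.Icc m M, ∀ x₃ ∈ Set.Icc m M,
        δ ≤ scalingRate c₁₂ c₁₃ c₂₃ x₁ x₂ x₃ := by
  let I := Set.Icc (0 : ℝ) 1
  let J := Set.Icc m M
  let S : Set ((ℝ × ℝ × ℝ) × ℝ × ℝ × ℝ) := (I ×ˢ I ×ˢ I) ×ˢ J ×ˢ J ×ˢ J
  have hS : IsCompact S := ((isCompact_Icc.prod (isCompact_Icc.prod isCompact_Icc))).prod
    (isCompact_Icc.prod (isCompact_Icc.prod isCompact_Icc))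
  have hne : S.Nonempty := ⟨((0, 0, 0), m, m, m), by simp [S, I, J, hmM]⟩
  have hp : Continuous fun a : (ℝ × ℝ × ℝ) × ℝ × ℝ × ℝ => coshEdge a.1.1 a.2.1 a.2.2.1 :=
    continuous_coshEdge.comp (by fun_prop :
      Continuous fun a : (ℝ × ℝ × ℝ) × ℝ × ℝ × ℝ => (a.1.1, a.2.1, a.2.2.1))
  have hq : Continuous fun a : (ℝ × ℝ × ℝ) × ℝ × ℝ × ℝ => coshEdge a.1.2.1 a.2.1 a.2.2.2 :=
    continuous_coshEdge.comp (by fun_prop :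
      Continuous fun a : (ℝ × ℝ × ℝ) × ℝ × ℝ × ℝ => (a.1.2.1, a.2.1, a.2.2.2))
  have hs : Continuous fun a : (ℝ × ℝ × ℝ) × ℝ × ℝ × ℝ => coshEdge a.1.2.2 a.2.2.1 a.2.2.2 :=
    continuous_coshEdge.comp (by fun_prop :
      Continuous fun a : (ℝ × ℝ × ℝ) × ℝ × ℝ × ℝ => (a.1.2.2, a.2.2.1, a.2.2.2))
  have hp1 : ∀ a ∈ S, 1 < coshEdge a.1.1 a.2.1 a.2.2.1 := fun a ha =>
    one_lt_coshEdge ha.1.1.1 (hm.trans_le ha.2.1.1) (hm.trans_le ha.2.2.1.1)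
  have hq1 : ∀ a ∈ S, 1 < coshEdge a.1.2.1 a.2.1 a.2.2.2 := fun a ha =>
    one_lt_coshEdge ha.1.2.1.1 (hm.trans_le ha.2.1.1) (hm.trans_le ha.2.2.2.1)
  have hcont : ContinuousOn (fun a : (ℝ × ℝ × ℝ) × ℝ × ℝ × ℝ =>
      scalingRate a.1.1 a.1.2.1 a.1.2.2 a.2.1 a.2.2.1 a.2.2.2) S := by
    unfold scalingRate
    refine ContinuousOn.div (ContinuousOn.sub (ContinuousOn.sub (by fun_prop)
      (ContinuousOn.div (by fun_prop) (hp.add continuous_const).continuousOn fun a ha => ?_))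
      (ContinuousOn.div (by fun_prop) (hq.add continuous_const).continuousOn fun a ha => ?_))
      (by fun_prop) fun a ha => ?_
    · linarith [hp1 a ha]
    · linarith [hq1 a ha]
    · exact (mul_pos (sqrt_sq_sub_one_pos (hp1 a ha)) (sqrt_sq_sub_one_pos (hq1 a ha))).ne'
  obtain ⟨a, ha, hmin⟩ := hS.exists_isMinOn hne hcont
  refine ⟨_, scalingRate_pos ha.1.1 ha.1.2.1 ha.1.2.2 (hm.trans_le ha.2.1.1)
    (hm.trans_le ha.2.2.1.1) (hm.trans_le ha.2.2.2.1), ?_⟩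
  intro c₁₂ h₁₂ c₁₃ h₁₃ c₂₃ h₂₃ x₁ h₁ x₂ h₂ x₃ h₃
  exact hmin (show ((c₁₂, c₁₃, c₂₃), x₁, x₂, x₃) ∈ S from ⟨⟨h₁₂, h₁₃, h₂₃⟩, h₁, h₂, h₃⟩)

/-- If, from `z` to `x`, the conformal coordinate of the first vertex increases, and at least as much
as the other two, then the cosine of the angle at the first vertex grows by at least a fixed
multiple of this increase. The constant is uniform in the weights and on bounded boxes. -/
theorem exists_cosAngle_growth {m M : ℝ} (hm : 1 < m) (hmM : m ≤ M) :
    ∃ δ > 0, ∀ c₁₂ ∈ Set.Icc (0 : ℝ) 1, ∀ c₁₃ ∈ Set.Icc (0 : ℝ) 1, ∀ c₂₃ ∈ Set.Icc (0 : ℝ) 1,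
      ∀ x₁ ∈ Set.Icc m M, ∀ x₂ ∈ Set.Icc m M, ∀ x₃ ∈ Set.Icc m M,
      ∀ z₁ ∈ Set.Icc m M, ∀ z₂ ∈ Set.Icc m M, ∀ z₃ ∈ Set.Icc m M,
        0 ≤ conformalCoord x₁ - conformalCoord z₁ →
        conformalCoord x₂ - conformalCoord z₂ ≤ conformalCoord x₁ - conformalCoord z₁ →
        conformalCoord x₃ - conformalCoord z₃ ≤ conformalCoord x₁ - conformalCoord z₁ →
        δ * (conformalCoord x₁ - conformalCoord z₁) ≤
          cosAngle c₁₂ c₁₃ c₂₃ x₁ x₂ x₃ - cosAngle c₁₂ c₁₃ c₂₃ z₁ z₂ z₃ := by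
  obtain ⟨δ, hδ, hrate⟩ := exists_scalingRate_lower_bound hm hmM
  refine ⟨δ, hδ, ?_⟩
  intro c₁₂ h₁₂ c₁₃ h₁₃ c₂₃ h₂₃ x₁ hx₁ x₂ hx₂ x₃ hx₃ z₁ hz₁ z₂ hz₂ z₃ hz₃ hv₁ hv₂ hv₃
  -- the segment from `z` to `x` in the conformal coordinate
  let path : ℝ → ℝ → ℝ → ℝ := fun x z t =>
    coshOfConformal (conformalCoord z + t * (conformalCoord x - conformalCoord z))
  have hM : 1 < M := hm.trans_le hmM
  have hseg : ∀ {x z t : ℝ}, x ∈ Set.Icc m M → z ∈ Set.Icc m M → t ∈ Set.Icc (0 : ℝ) 1 →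
      conformalCoord z + t * (conformalCoord x - conformalCoord z) ∈
        Set.Icc (conformalCoord m) (conformalCoord M) := by
    intro x z t hx hz ht
    refine (convex_Icc _ _).add_smul_sub_mem ?_ ?_ ht
    · exact ⟨conformalCoord_le_conformalCoord hm hz.1,
        conformalCoord_le_conformalCoord (hm.trans_le hz.1) hz.2⟩
    · exact ⟨conformalCoord_le_conformalCoord hm hx.1,
        conformalCoord_le_conformalCoord (hm.trans_le hx.1) hx.2⟩
  have hmem : ∀ {x z t : ℝ}, x ∈ Set.Icc m M → z ∈ Set.Icc m M → t ∈ Set.Icc (0 : ℝ) 1 →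
      path x z t ∈ Set.Icc m M := by
    intro x z t hx hz ht
    have h := hseg hx hz ht
    have h1 := coshOfConformal_le_coshOfConformal h.1 (h.2.trans_lt (conformalCoord_neg hM))
    have h2 := coshOfConformal_le_coshOfConformal h.2 (conformalCoord_neg hM)
    rw [coshOfConformal_conformalCoord hm] at h1
    rw [coshOfConformal_conformalCoord hM] at h2
    exact ⟨h1, h2⟩
  have hpath : ∀ {x z t : ℝ}, x ∈ Set.Icc m M → z ∈ Set.Icc m M → t ∈ Set.Icc (0 : ℝ) 1 →
      HasDerivAt (path x z) ((conformalCoord x - conformalCoord z) * (path x z t ^ 2 - 1)) t := by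
    intro x z t hx hz ht
    have h := hasDerivAt_coshOfConformal ((hseg hx hz ht).2.trans_lt (conformalCoord_neg hM))
    have hl : HasDerivAt (fun t => conformalCoord z + t * (conformalCoord x - conformalCoord z))
        (conformalCoord x - conformalCoord z) t := by
      simpa using ((hasDerivAt_id t).mul_const
        (conformalCoord x - conformalCoord z)).const_add (conformalCoord z)
    rw [mul_comm]
    exact h.comp t hl
  have hder : ∀ t ∈ Set.Icc (0 : ℝ) 1, ∃ d, HasDerivAt
      (fun t => cosAngle c₁₂ c₁₃ c₂₃ (path x₁ z₁ t) (path x₂ z₂ t) (path x₃ z₃ t)) d t ∧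
      δ * (conformalCoord x₁ - conformalCoord z₁) ≤ d := by
    intro t ht
    have k₁ := hmem hx₁ hz₁ ht
    have k₂ := hmem hx₂ hz₂ ht
    have k₃ := hmem hx₃ hz₃ ht
    obtain ⟨d, hd, hle⟩ := exists_hasDerivAt_cosAngle h₁₂ h₁₃ h₂₃ (hpath hx₁ hz₁ ht)
      (hpath hx₂ hz₂ ht) (hpath hx₃ hz₃ ht) (hm.trans_le k₁.1) (hm.trans_le k₂.1)
      (hm.trans_le k₃.1) hv₂ hv₃
    refine ⟨d, hd, le_trans ?_ hle⟩
    rw [mul_comm]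
    exact mul_le_mul_of_nonneg_left (hrate _ h₁₂ _ h₁₃ _ h₂₃ _ k₁ _ k₂ _ k₃) hv₁
  have hmvt := (convex_Icc (0 : ℝ) 1).mul_sub_le_image_sub_of_le_deriv
    (f := fun t => cosAngle c₁₂ c₁₃ c₂₃ (path x₁ z₁ t) (path x₂ z₂ t) (path x₃ z₃ t))
    (C := δ * (conformalCoord x₁ - conformalCoord z₁))
    (fun t ht => (hder t ht).choose_spec.1.continuousAt.continuousWithinAt)
    (fun t ht => (hder t
      (interior_subset ht)).choose_spec.1.differentiableAt.differentiableWithinAt)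
    (fun t ht => by
      obtain ⟨d, hd, hle⟩ := hder t (interior_subset ht)
      rwa [hd.deriv])
    0 (by simp) 1 (by simp) zero_le_one
  have e : ∀ {x z : ℝ}, x ∈ Set.Icc m M → z ∈ Set.Icc m M → path x z 0 = z ∧ path x z 1 = x := by
    intro x z hx hz
    simp [path, coshOfConformal_conformalCoord (hm.trans_le hx.1),
      coshOfConformal_conformalCoord (hm.trans_le hz.1)]
  simpa [(e hx₁ hz₁).1, (e hx₂ hz₂).1, (e hx₃ hz₃).1, (e hx₁ hz₁).2, (e hx₂ hz₂).2,
    (e hx₃ hz₃).2] using hmvt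

section Smooth

variable {E : Type*} [NormedAddCommGroup E] [NormedSpace ℝ E]

theorem contDiffAt_coshEdge {f g : E → ℝ} {a : E} (c : ℝ) (hf : ContDiffAt ℝ 1 f a)
    (hg : ContDiffAt ℝ 1 g a) (hf1 : 1 < f a) (hg1 : 1 < g a) :
    ContDiffAt ℝ 1 (fun x => coshEdge c (f x) (g x)) a := by
  unfold coshEdge
  have h1 : f a ^ 2 - 1 ≠ 0 := by nlinarith
  have h2 : g a ^ 2 - 1 ≠ 0 := by nlinarith
  exact (hf.mul hg).add (((((hf.pow 2).sub contDiffAt_const).sqrt h1).mul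
    (((hg.pow 2).sub contDiffAt_const).sqrt h2)).mul contDiffAt_const)

theorem contDiffAt_arccos_cosAngle {f g h : E → ℝ} {a : E} {c₁₂ c₁₃ c₂₃ : ℝ}
    (hc₁₂ : c₁₂ ∈ Set.Icc 0 1) (hc₁₃ : c₁₃ ∈ Set.Icc 0 1) (hc₂₃ : c₂₃ ∈ Set.Icc 0 1)
    (hf : ContDiffAt ℝ 1 f a) (hg : ContDiffAt ℝ 1 g a) (hh : ContDiffAt ℝ 1 h a)
    (hf1 : 1 < f a) (hg1 : 1 < g a) (hh1 : 1 < h a) :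
    ContDiffAt ℝ 1 (fun x => Real.arccos (cosAngle c₁₂ c₁₃ c₂₃ (f x) (g x) (h x))) a := by
  have hlt := abs_lt.mp (abs_cosAngle_lt_one hc₁₂ hc₁₃ hc₂₃ hf1 hg1 hh1)
  refine ContDiffAt.comp (g := Real.arccos)
    (f := fun x => cosAngle c₁₂ c₁₃ c₂₃ (f x) (g x) (h x)) a
    (Real.contDiffAt_arccos hlt.1.ne' hlt.2.ne) ?_
  have hp := contDiffAt_coshEdge c₁₂ hf hg hf1 hg1
  have hq := contDiffAt_coshEdge c₁₃ hf hh hf1 hh1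
  have hp1 := one_lt_coshEdge hc₁₂.1 hf1 hg1
  have hq1 := one_lt_coshEdge hc₁₃.1 hf1 hh1
  exact ((hp.mul hq).sub (contDiffAt_coshEdge c₂₃ hg hh hg1 hh1)).div
    ((((hp.pow 2).sub contDiffAt_const).sqrt (by nlinarith)).mul
      (((hq.pow 2).sub contDiffAt_const).sqrt (by nlinarith)))
    (mul_pos (sqrt_sq_sub_one_pos hp1) (sqrt_sq_sub_one_pos hq1)).ne'

end Smooth

/-! ### Angles and curvature in terms of the hyperbolic cosines of the radii -/

theorem sub_le_arccos_sub_arccos {a b : ℝ} (ha : a ∈ Set.Icc (-1) 1) (hb : b ∈ Set.Icc (-1) 1)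
    (hab : a ≤ b) : b - a ≤ Real.arccos a - Real.arccos b := by
  have h := Real.abs_cos_sub_cos_le (Real.arccos b) (Real.arccos a)
  rw [Real.cos_arccos hb.1 hb.2, Real.cos_arccos ha.1 ha.2, abs_of_nonneg (sub_nonneg.mpr hab),
    abs_sub_comm, abs_of_nonneg (sub_nonneg.mpr (Real.arccos_le_arccos hab))] at h
  exact h

theorem hypAngle_eq_arccos_cosAngle {V : Type*} {Φ : Sym2 V → ℝ} {r : V → ℝ}
    (hr : IsCirclePackingMetric r) {i j k : V} (hij : 0 ≤ Real.cos (Φ s(i, j)))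
    (hik : 0 ≤ Real.cos (Φ s(i, k))) (hjk : 0 ≤ Real.cos (Φ s(j, k))) :
    hypAngle Φ r i j k = Real.arccos (cosAngle (Real.cos (Φ s(i, j))) (Real.cos (Φ s(i, k)))
      (Real.cos (Φ s(j, k))) (Real.cosh (r i)) (Real.cosh (r j)) (Real.cosh (r k))) := by
  have hedge : ∀ {a b : V}, 0 ≤ Real.cos (Φ s(a, b)) →
      1 < coshEdge (Real.cos (Φ s(a, b))) (Real.cosh (r a)) (Real.cosh (r b)) ∧
      hypEdgeLength Φ r a b =
        Real.arcosh (coshEdge (Real.cos (Φ s(a, b))) (Real.cosh (r a)) (Real.cosh (r b))) := by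
    intro a b hc
    refine ⟨one_lt_coshEdge hc (Real.one_lt_cosh.mpr (hr a).ne')
      (Real.one_lt_cosh.mpr (hr b).ne'), ?_⟩
    have hs : ∀ v, √(Real.cosh (r v) ^ 2 - 1) = Real.sinh (r v) := fun v => by
      rw [← Real.sinh_sq, Real.sqrt_sq (Real.sinh_nonneg_iff.mpr (hr v).le)]
    rw [hypEdgeLength, coshEdge, hs, hs]
  obtain ⟨h1, e1⟩ := hedge hij
  obtain ⟨h2, e2⟩ := hedge hik
  obtain ⟨h3, e3⟩ := hedge hjk
  rw [hypAngle, e1, e2, e3, Real.cosh_arcosh h1.le, Real.cosh_arcosh h2.le,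
    Real.cosh_arcosh h3.le, Real.sinh_arcosh h1.le, Real.sinh_arcosh h2.le]
  rfl

namespace SurfaceTriangulation

variable {V : Type*} [Fintype V] [DecidableEq V] {X : Type*} [TopologicalSpace X]

theorem IsWeight.cos_mem {T : SurfaceTriangulation V X} {Φ : Sym2 V → ℝ} (hΦ : T.IsWeight Φ)
    {i j k : V} (h : {i, j, k} ∈ T.triangleSet) :
    Real.cos (Φ s(i, j)) ∈ Set.Icc 0 1 ∧ Real.cos (Φ s(i, k)) ∈ Set.Icc 0 1 ∧
      Real.cos (Φ s(j, k)) ∈ Set.Icc 0 1 := by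
  obtain ⟨hface, hcard⟩ := h
  have hij : i ≠ j := by
    rintro rfl
    have := Finset.card_le_two (a := i) (b := k)
    simp at hcard
    omega
  have hik : i ≠ k := by
    rintro rfl
    have := Finset.card_le_two (a := j) (b := i)
    simp at hcard
    omega
  have hjk : j ≠ k := by
    rintro rfl
    have := Finset.card_le_two (a := i) (b := j)
    simp at hcard
    omega
  have hedge : ∀ {a b : V}, a ≠ b → ({a, b} : Finset V) ⊆ {i, j, k} →
      Real.cos (Φ s(a, b)) ∈ Set.Icc 0 1 := by
    intro a b hab hsub
    have hmem : s(a, b) ∈ T.edgeSet := by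
      refine ⟨by simpa using hab, ?_⟩
      have : (s(a, b)).toFinset = {a, b} := by ext; simp
      rw [this]
      exact (T.complex.isRelLowerSet_faces hface).2 hsub ⟨a, by simp⟩
    have hmem' := hΦ _ hmem
    exact ⟨Real.cos_nonneg_of_neg_pi_div_two_le_of_le (by linarith [Real.pi_pos, hmem'.1]) hmem'.2,
      Real.cos_le_one _⟩
  refine ⟨hedge hij ?_, hedge hik ?_, hedge hjk ?_⟩ <;> intro v <;> simp <;> tauto

open Classical in
/-- The angle at `i` in the triangle `{i, j, k}`, in terms of the hyperbolic cosines `x` of the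
radii; it is `0` if `{i, j, k}` is not a triangle of `T`. -/
noncomputable def coshAngle (T : SurfaceTriangulation V X) (Φ : Sym2 V → ℝ) (x : V → ℝ)
    (i j k : V) : ℝ :=
  if {i, j, k} ∈ T.triangleSet then Real.arccos (cosAngle (Real.cos (Φ s(i, j)))
    (Real.cos (Φ s(i, k))) (Real.cos (Φ s(j, k))) (x i) (x j) (x k)) else 0

/-- The Gauss curvature in terms of the hyperbolic cosines `x` of the radii. It is defined for all
`x`, and meaningful where all `x i` exceed `1`. -/
noncomputable def coshCurvature (T : SurfaceTriangulation V X) (Φ : Sym2 V → ℝ) (x : V → ℝ)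
    (i : V) : ℝ :=
  2 * Real.pi - (1 / 2) * ∑ j, ∑ k, T.coshAngle Φ x i j k

variable {T : SurfaceTriangulation V X} {Φ : Sym2 V → ℝ}

theorem gaussCurvature_eq_coshCurvature (hΦ : T.IsWeight Φ) {r : V → ℝ}
    (hr : IsCirclePackingMetric r) (i : V) :
    T.gaussCurvature Φ r i = T.coshCurvature Φ (fun j => Real.cosh (r j)) i := by
  unfold gaussCurvature coshCurvature coshAngle
  congr 2
  refine Finset.sum_congr rfl fun j _ => Finset.sum_congr rfl fun k _ => ?_
  split_ifs with h
  · obtain ⟨h1, h2, h3⟩ := hΦ.cos_mem h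
    exact hypAngle_eq_arccos_cosAngle hr h1.1 h2.1 h3.1
  · rfl

theorem contDiffAt_coshCurvature (hΦ : T.IsWeight Φ) {x : V → ℝ} (hx : ∀ i, 1 < x i) (i : V) :
    ContDiffAt ℝ 1 (fun x => T.coshCurvature Φ x i) x := by
  unfold coshCurvature
  refine contDiffAt_const.sub (contDiffAt_const.mul (ContDiffAt.sum fun j _ =>
    ContDiffAt.sum fun k _ => ?_))
  unfold coshAngle
  split_ifs with h
  · obtain ⟨h1, h2, h3⟩ := hΦ.cos_mem h
    exact contDiffAt_arccos_cosAngle h1 h2 h3 (contDiffAt_apply ..) (contDiffAt_apply ..)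
      (contDiffAt_apply ..) (hx i) (hx j) (hx k)
  · exact contDiffAt_const

/-- The curvature at a vertex is positive when the radius there is large, whatever the other radii. -/
theorem exists_forall_coshCurvature_pos (hΦ : T.IsWeight Φ) :
    ∃ M > 1, ∀ x : V → ℝ, (∀ j, 1 < x j) → ∀ i, M ≤ x i → 0 < T.coshCurvature Φ x i := by
  set n : ℝ := ((Fintype.card V : ℕ) : ℝ)
  have hn : 0 ≤ n := Nat.cast_nonneg _
  have hlim : Tendsto (fun x : ℝ => Real.arccos (1 - 2 / (x ^ 2 - 1))) atTop (𝓝 0) := by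
    rw [← Real.arccos_one]
    refine (Real.continuous_arccos.tendsto 1).comp ?_
    have : Tendsto (fun x : ℝ => x ^ 2 - 1) atTop atTop :=
      tendsto_atTop_add_const_right _ _ (tendsto_pow_atTop two_ne_zero)
    simpa using (this.const_div_atTop 2).const_sub 1
  -- each of the `n * n` summands is made so small that their sum is at most `π`
  obtain ⟨M, hM⟩ := eventually_atTop.mp
    (hlim.eventually_lt_const (show 0 < Real.pi / (n * n + 1) by positivity))
  refine ⟨max M 2, by simp, fun x hx i hi => ?_⟩
  set ε := Real.pi / (n * n + 1)
  have hle : ∀ j k, T.coshAngle Φ x i j k ≤ ε := by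
    intro j k
    unfold coshAngle
    split_ifs with h
    · obtain ⟨h1, h2, h3⟩ := hΦ.cos_mem h
      exact (Real.arccos_le_arccos (le_cosAngle h1.1 h2.1 h3.2 (hx i) (hx j)
        (hx k))).trans (hM _ ((le_max_left _ _).trans hi)).le
    · positivity
  have hsum : ∑ j, ∑ k, T.coshAngle Φ x i j k ≤ n * n * ε := by
    calc ∑ j, ∑ k, T.coshAngle Φ x i j k ≤ ∑ _j : V, ∑ _k : V, ε :=
          Finset.sum_le_sum fun j _ => Finset.sum_le_sum fun k _ => hle j k
      _ = n * n * ε := by simp [n, mul_assoc]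
  have hε : n * n * ε ≤ Real.pi := by
    have : n * n * ε = Real.pi * (n * n / (n * n + 1)) := by simp only [ε]; ring
    rw [this]
    exact mul_le_of_le_one_right Real.pi_pos.le (div_le_one_of_le₀ (by linarith) (by positivity))
  unfold coshCurvature
  linarith [Real.pi_pos]

/-- An isolated vertex would have curvature `2 * π`. -/
theorem exists_triangle_of_coshCurvature_eq_zero {x : V → ℝ} {i : V}
    (h : T.coshCurvature Φ x i = 0) : ∃ j k, {i, j, k} ∈ T.triangleSet := by
  by_contra! hcon
  have : ∀ j k, T.coshAngle Φ x i j k = 0 := fun j k => if_neg (hcon j k)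
  simp [coshCurvature, this, Real.pi_ne_zero] at h

/-- The maximum principle for the curvature. Exchanging `x` and `z` gives the corresponding statement
at a vertex at which the difference of the conformal coordinates is minimal and nonpositive. -/
theorem exists_coshCurvature_growth (hΦ : T.IsWeight Φ) {m M : ℝ} (hm : 1 < m) (hmM : m ≤ M) :
    ∃ δ > 0, ∀ x z : V → ℝ, (∀ j, x j ∈ Set.Icc m M) → (∀ j, z j ∈ Set.Icc m M) → ∀ i,
      (∃ j k, {i, j, k} ∈ T.triangleSet) →
      0 ≤ conformalCoord (x i) - conformalCoord (z i) →
      (∀ j, conformalCoord (x j) - conformalCoord (z j) ≤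
        conformalCoord (x i) - conformalCoord (z i)) →
      δ * (conformalCoord (x i) - conformalCoord (z i)) ≤
        T.coshCurvature Φ x i - T.coshCurvature Φ z i := by
  obtain ⟨δ, hδ, H⟩ := exists_cosAngle_growth hm hmM
  refine ⟨δ / 2, by positivity, fun x z hx hz i ⟨j₀, k₀, h₀⟩ hvi hv => ?_⟩
  set v := conformalCoord (x i) - conformalCoord (z i)
  have hterm : ∀ j k, {i, j, k} ∈ T.triangleSet →
      δ * v ≤ T.coshAngle Φ z i j k - T.coshAngle Φ x i j k := by
    intro j k h
    obtain ⟨h1, h2, h3⟩ := hΦ.cos_mem h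
    have hgrow := H _ h1 _ h2 _ h3 _ (hx i) _ (hx j) _ (hx k) _ (hz i) _ (hz j) _ (hz k) hvi
      (hv j) (hv k)
    have hmem : ∀ w : V → ℝ, (∀ j, w j ∈ Set.Icc m M) →
        cosAngle (Real.cos (Φ s(i, j))) (Real.cos (Φ s(i, k))) (Real.cos (Φ s(j, k)))
          (w i) (w j) (w k) ∈ Set.Icc (-1) 1 := fun w hw =>
      abs_le.mp (abs_cosAngle_lt_one h1 h2 h3 (hm.trans_le (hw i).1) (hm.trans_le (hw j).1)
        (hm.trans_le (hw k).1)).le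
    simp only [coshAngle, if_pos h]
    refine hgrow.trans (sub_le_arccos_sub_arccos (hmem z hz) (hmem x hx) ?_)
    have : 0 ≤ δ * v := by positivity
    exact sub_nonneg.mp (this.trans hgrow)
  have hnonneg : ∀ j k, 0 ≤ T.coshAngle Φ z i j k - T.coshAngle Φ x i j k := by
    intro j k
    by_cases h : {i, j, k} ∈ T.triangleSet
    · exact le_trans (by positivity) (hterm j k h)
    · simp [coshAngle, h]
  have hsum : δ * v ≤ ∑ j, ∑ k, (T.coshAngle Φ z i j k - T.coshAngle Φ x i j k) :=
    calc δ * v ≤ T.coshAngle Φ z i j₀ k₀ - T.coshAngle Φ x i j₀ k₀ := hterm j₀ k₀ h₀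
      _ ≤ ∑ k, (T.coshAngle Φ z i j₀ k - T.coshAngle Φ x i j₀ k) :=
        Finset.single_le_sum (f := fun k => T.coshAngle Φ z i j₀ k - T.coshAngle Φ x i j₀ k)
          (fun k _ => hnonneg j₀ k) (Finset.mem_univ k₀)
      _ ≤ _ := Finset.single_le_sum
          (f := fun j => ∑ k, (T.coshAngle Φ z i j k - T.coshAngle Φ x i j k))
          (fun j _ => Finset.sum_nonneg fun k _ => hnonneg j k) (Finset.mem_univ j₀)
  simp only [Finset.sum_sub_distrib] at hsum
  unfold coshCurvature
  linarith

/-- The vector field of the combinatorial Ricci flow in the coordinates `x i = cosh (r i)`. As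
`sinh (r i / 2) ^ 2 = (x i - 1) / 2`, it is twice the field of the flow of `g`. -/
noncomputable def coshField (T : SurfaceTriangulation V X) (Φ : Sym2 V → ℝ) (x : V → ℝ) :
    V → ℝ :=
  fun i => -T.coshCurvature Φ x i / (2 * Real.pi)

theorem contDiffAt_coshField (hΦ : T.IsWeight Φ) {x : V → ℝ} (hx : ∀ i, 1 < x i) :
    ContDiffAt ℝ 1 (T.coshField Φ) x :=
  contDiffAt_pi.mpr fun i => (contDiffAt_coshCurvature hΦ hx i).neg.div_const _

theorem sinh_half_sq (r : ℝ) : Real.sinh (r / 2) ^ 2 = (Real.cosh r - 1) / 2 := by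
  have h := Real.cosh_two_mul (r / 2)
  rw [mul_div_cancel₀ _ two_ne_zero, Real.cosh_sq] at h
  linarith

/-- The combinatorial Ricci flow in the coordinates `x i = cosh (r i)`. -/
theorem isRicciFlowOn_iff (hΦ : T.IsWeight Φ) {I : Set ℝ} {r : ℝ → V → ℝ} :
    T.IsRicciFlowOn Φ I r ↔ ∀ t ∈ I, IsCirclePackingMetric (r t) ∧
      HasDerivWithinAt (fun s i => Real.cosh (r s i))
        (T.coshField Φ fun i => Real.cosh (r t i)) I t := by
  unfold IsRicciFlowOn
  refine forall₂_congr fun t _ => and_congr_right fun hr => ?_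
  rw [hasDerivWithinAt_pi]
  refine forall_congr' fun i => ?_
  have hpos : Real.sinh (r t i / 2) ≠ 0 := (Real.sinh_pos_iff.mpr (half_pos (hr i))).ne'
  have hval : -(T.modifiedCurvature Φ (r t) i) * Real.sinh (r t i / 2) ^ 2 =
      T.coshField Φ (fun i => Real.cosh (r t i)) i / 2 := by
    rw [modifiedCurvature, coshField, gaussCurvature_eq_coshCurvature hΦ hr]
    have := Real.pi_ne_zero
    field_simp
    norm_num
  rw [hval]
  simp only [sinh_half_sq]
  constructor
  · intro h
    have := (h.const_mul 2).add_const 1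
    convert! this using 1
    · ext s; ring
    · ring
  · intro h
    exact (h.sub_const 1).div_const 2

theorem isZeroCurvatureMetric_iff (hΦ : T.IsWeight Φ) {r : V → ℝ} :
    T.IsZeroCurvatureMetric Φ r ↔ IsCirclePackingMetric r ∧
      ∀ i, T.coshCurvature Φ (fun j => Real.cosh (r j)) i = 0 := by
  refine and_congr_right fun hr => forall_congr' fun i => ?_
  have hpos : Real.sinh (r i / 2) ≠ 0 := (Real.sinh_pos_iff.mpr (half_pos (hr i))).ne'
  rw [modifiedCurvature, gaussCurvature_eq_coshCurvature hΦ hr, div_eq_zero_iff]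
  simp [hpos, Real.pi_ne_zero]

end SurfaceTriangulation

/-! ### Existence, uniqueness and convergence of the flow -/

namespace SurfaceTriangulation

variable {V : Type*} [Fintype V] [DecidableEq V] {X : Type*} [TopologicalSpace X]
  {T : SurfaceTriangulation V X} {Φ : Sym2 V → ℝ}

/-- A box on which the field points inward, containing the initial metric and the zero curvature
metric `xs`. Its upper faces lie at a radius so large that the curvature is positive there; its
lower faces lie at distance `N` below `xs` in the conformal coordinates, where the maximum principle
makes the curvature negative. -/
theorem exists_pointsInward_coshField (hΦ : T.IsWeight Φ) {xs x₀ : V → ℝ} (hxs : ∀ i, 1 < xs i)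
    (hzero : ∀ i, T.coshCurvature Φ xs i = 0) (hx₀ : ∀ i, 1 < x₀ i) :
    ∃ m M N : ℝ, ∃ lo : V → ℝ, 1 < m ∧ m ≤ M ∧ 0 < N ∧ (∀ i, m ≤ lo i) ∧
      PointsInward (T.coshField Φ) lo (fun _ => M) ∧ x₀ ∈ Set.Icc lo (fun _ => M) ∧
      xs ∈ Set.Icc lo (fun _ => M) ∧
      ∀ i, |conformalCoord (x₀ i) - conformalCoord (xs i)| ≤ N := by
  obtain ⟨M₀, hM₀, hbarrier⟩ := exists_forall_coshCurvature_pos hΦ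
  have hsum : ∀ (f : V → ℝ), (∀ i, 0 ≤ f i) → ∀ i, f i ≤ ∑ j, f j := fun f hf i =>
    Finset.single_le_sum (fun j _ => hf j) (Finset.mem_univ i)
  -- the sums serve as upper bounds of all their terms, also when there are no vertices
  set N : ℝ := 1 + ∑ j, |conformalCoord (x₀ j) - conformalCoord (xs j)|
  have hvN : ∀ i, |conformalCoord (x₀ i) - conformalCoord (xs i)| ≤ N := fun i => by
    have := hsum (fun j => |conformalCoord (x₀ j) - conformalCoord (xs j)|)
      (fun _ => abs_nonneg _) i
    simp only [N]
    linarith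
  have hN : 0 < N := by positivity
  set B : ℝ := N + ∑ j, |conformalCoord (xs j)|
  have hB : ∀ i, -B ≤ conformalCoord (xs i) - N := fun i => by
    have h1 := hsum (fun j => |conformalCoord (xs j)|) (fun _ => abs_nonneg _) i
    have h2 := neg_abs_le (conformalCoord (xs i))
    simp only [B]
    linarith
  have hB0 : -B < 0 := by
    have : 0 < B := by positivity
    linarith
  have hlo0 : ∀ i, conformalCoord (xs i) - N < 0 := fun i => by
    linarith [conformalCoord_neg (hxs i)]
  set m := coshOfConformal (-B)
  have hm : 1 < m := one_lt_coshOfConformal hB0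
  set lo : V → ℝ := fun i => coshOfConformal (conformalCoord (xs i) - N)
  have hmlo : ∀ i, m ≤ lo i := fun i => coshOfConformal_le_coshOfConformal (hB i) (hlo0 i)
  set M : ℝ := M₀ + m + ∑ j, x₀ j + ∑ j, xs j
  have hpos₀ : 0 ≤ ∑ j, x₀ j := Finset.sum_nonneg fun j _ => by linarith [hx₀ j]
  have hpos₁ : 0 ≤ ∑ j, xs j := Finset.sum_nonneg fun j _ => by linarith [hxs j]
  have hmM : m ≤ M := by simp only [M]; linarith
  have hM₀M : M₀ ≤ M := by simp only [M]; linarith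
  have hx₀M : ∀ i, x₀ i ≤ M := fun i => by
    have := hsum x₀ (fun j => by linarith [hx₀ j]) i
    simp only [M]; linarith
  have hxsM : ∀ i, xs i ≤ M := fun i => by
    have := hsum xs (fun j => by linarith [hxs j]) i
    simp only [M]; linarith
  have hlo : ∀ {x : ℝ} {i : V}, 1 < x → conformalCoord (xs i) - N ≤ conformalCoord x →
      lo i ≤ x := by
    intro x i hx h
    have := coshOfConformal_le_coshOfConformal h (conformalCoord_neg hx)
    rwa [coshOfConformal_conformalCoord hx] at this
  have hxslo : ∀ i, lo i ≤ xs i := fun i => hlo (hxs i) (by linarith)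
  obtain ⟨δ, hδ, hgrow⟩ := exists_coshCurvature_growth hΦ hm hmM
  refine ⟨m, M, N, lo, hm, hmM, hN, hmlo, ?_, ⟨fun i => hlo (hx₀ i) ?_, hx₀M⟩, ⟨hxslo, hxsM⟩,
    hvN⟩
  · intro x hx i
    have hbox : ∀ j, x j ∈ Set.Icc m M := fun j => ⟨(hmlo j).trans (hx.1 j), hx.2 j⟩
    constructor
    · intro hi
      have := hbarrier x (fun j => hm.trans_le (hbox j).1) i (hi ▸ hM₀M)
      exact div_neg_of_neg_of_pos (neg_neg_of_pos this) Real.two_pi_pos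
    · intro hi
      have hv : ∀ j, conformalCoord (xs j) - conformalCoord (x j) ≤ N := fun j => by
        have := conformalCoord_le_conformalCoord (hm.trans_le (hmlo j)) (hx.1 j)
        rw [conformalCoord_coshOfConformal (hlo0 j)] at this
        linarith
      have hvi : conformalCoord (xs i) - conformalCoord (x i) = N := by
        rw [hi, conformalCoord_coshOfConformal (hlo0 i)]
        ring
      have h := hgrow xs x (fun j => ⟨(hmlo j).trans (hxslo j), hxsM j⟩) hbox i
        (exists_triangle_of_coshCurvature_eq_zero (hzero i)) (by rw [hvi]; exact hN.le)
        (fun j => by rw [hvi]; exact hv j)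
      rw [hvi, hzero i] at h
      have : 0 < δ * N := by positivity
      exact div_pos (by linarith) Real.two_pi_pos
  · linarith [(abs_le.mp (hvN i)).1]

/-- The distance to the zero curvature metric, in the maximum norm of the conformal coordinates,
decays exponentially along a solution that stays in a box. -/
theorem exists_exponential_contraction (hΦ : T.IsWeight Φ) {xs : V → ℝ}
    (hzero : ∀ i, T.coshCurvature Φ xs i = 0) {m M N : ℝ} (hm : 1 < m) (hmM : m ≤ M) (hN : 0 < N)
    (hxs : ∀ i, xs i ∈ Set.Icc m M) {x : ℝ → V → ℝ} (hx : ∀ t ≥ 0, ∀ i, x t i ∈ Set.Icc m M)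
    (hd : ∀ t ≥ 0, HasDerivWithinAt x (T.coshField Φ (x t)) (Set.Ici 0) t)
    (h0 : ∀ i, |conformalCoord (x 0 i) - conformalCoord (xs i)| ≤ N) :
    ∃ c > 0, ∀ t ≥ 0, ∀ i,
      |conformalCoord (x t i) - conformalCoord (xs i)| ≤ N * Real.exp (-c * t) := by
  obtain ⟨δ, hδ, hgrow⟩ := exists_coshCurvature_growth hΦ hm hmM
  have hM2 : 0 < M ^ 2 - 1 := by nlinarith
  have hpi := Real.pi_pos
  set c : ℝ := δ / (4 * Real.pi * (M ^ 2 - 1)) with hc_def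
  have hc : 0 < c := by positivity
  refine ⟨c, hc, fun τ hτ => ?_⟩
  let v : V → ℝ → ℝ := fun i t => conformalCoord (x t i) - conformalCoord (xs i)
  let v' : V → ℝ → ℝ := fun i t => 1 / (x t i ^ 2 - 1) * T.coshField Φ (x t) i
  have hv : ∀ i, ∀ t ≥ 0, HasDerivWithinAt (v i) (v' i t) (Set.Ici 0) t := fun i t ht =>
    ((hasDerivAt_conformalCoord (hm.trans_le (hx t ht i).1)).comp_hasDerivWithinAt t
      (hasDerivWithinAt_pi.mp (hd t ht) i)).sub_const _
  have hE : ∀ t, HasDerivAt (fun t => N * Real.exp (-c * t)) (N * (Real.exp (-c * t) * -c)) t :=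
    fun t => by simpa using (((hasDerivAt_id t).const_mul (-c)).exp).const_mul N
  -- The conformal coordinate of a vertex of curvature `κ` moves with velocity
  -- `-κ / (2 * π * (x ^ 2 - 1))`; the constant `c` is half of what the growth bound yields for it,
  -- so that the barrier `N * exp (-c * t)` is strict.
  have hrate : ∀ t ≥ 0, ∀ i, ∀ k κ : ℝ, 0 ≤ k → δ * k ≤ κ →
      2 * c * k ≤ 1 / (x t i ^ 2 - 1) * (κ / (2 * Real.pi)) := by
    intro t ht i k κ hk h
    have hxi := hx t ht i
    have hx1 : 0 < x t i ^ 2 - 1 := by nlinarith [hxi.1]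
    have hxM : x t i ^ 2 - 1 ≤ M ^ 2 - 1 := by nlinarith [hxi.1, hxi.2]
    have e : 2 * c * k = 1 / (M ^ 2 - 1) * (δ * k / (2 * Real.pi)) := by
      rw [hc_def]
      field_simp
      norm_num
    have hδk : 0 ≤ δ * k := by positivity
    rw [e]
    gcongr
  have key := forall_nonpos_of_strict_barrier (κ := V ⊕ V) (T := τ)
    (φ := Sum.elim (fun i t => v i t - N * Real.exp (-c * t))
      (fun i t => -v i t - N * Real.exp (-c * t)))
    (φ' := Sum.elim (fun i t => v' i t - N * (Real.exp (-c * t) * -c))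
      (fun i t => -v' i t - N * (Real.exp (-c * t) * -c))) ?_ ?_ ?_ ?_ τ ⟨hτ, le_rfl⟩
  · intro i
    have h1 : v i τ - N * Real.exp (-c * τ) ≤ 0 := key (Sum.inl i)
    have h2 : -v i τ - N * Real.exp (-c * τ) ≤ 0 := key (Sum.inr i)
    exact abs_le.mpr ⟨by linarith, by linarith⟩
  · have hEc : Continuous fun t => N * Real.exp (-c * t) := by fun_prop
    have hvc : ∀ i, ContinuousOn (v i) (Set.Icc 0 τ) := fun i t ht =>
      (hv i t ht.1).continuousWithinAt.mono Set.Icc_subset_Ici_self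
    rintro (i | i)
    · exact (hvc i).sub hEc.continuousOn
    · exact (hvc i).neg.sub hEc.continuousOn
  · have hvr : ∀ i, ∀ t ∈ Set.Ico 0 τ, HasDerivWithinAt (v i) (v' i t) (Set.Ici t) t :=
      fun i t ht => (hv i t ht.1).mono (Set.Ici_subset_Ici.mpr ht.1)
    rintro (i | i) t ht
    · exact (hvr i t ht).sub (hE t).hasDerivWithinAt
    · exact (hvr i t ht).neg.sub (hE t).hasDerivWithinAt
  · rintro (i | i)
    · simpa [v] using (abs_le.mp (h0 i)).2
    · simpa [v] using neg_le.mp (abs_le.mp (h0 i)).1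
  · intro t ht hall i hi
    set k := N * Real.exp (-c * t) with hk_def
    have hk : 0 < k := by positivity
    have hup : ∀ j, v j t ≤ k := fun j => sub_nonpos.mp (hall (Sum.inl j))
    have hdown : ∀ j, -v j t ≤ k := fun j => sub_nonpos.mp (hall (Sum.inr j))
    have htri := fun i => exists_triangle_of_coshCurvature_eq_zero (hzero i)
    have hck : 0 < c * k := by positivity
    have ek : N * (Real.exp (-c * t) * -c) = -(c * k) := by rw [hk_def]; ring
    rcases i with i | i
    · have hik : v i t = k := sub_eq_zero.mp hi
      have h := hgrow (x t) xs (hx t ht.1) hxs i (htri i) (hk.le.trans_eq hik.symm)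
        (fun j => (hup j).trans_eq hik.symm)
      rw [show conformalCoord (x t i) - conformalCoord (xs i) = k from hik, hzero i, sub_zero] at h
      have := hrate t ht.1 i k _ hk.le h
      have e : v' i t = -(1 / (x t i ^ 2 - 1) * (T.coshCurvature Φ (x t) i / (2 * Real.pi))) := by
        simp only [v', coshField]
        ring
      change v' i t - N * (Real.exp (-c * t) * -c) < 0
      rw [ek]
      linarith
    · have hik : -v i t = k := sub_eq_zero.mp hi
      have hneg : ∀ j, conformalCoord (xs j) - conformalCoord (x t j) = -v j t := fun j => by
        simp only [v]; ring
      have h := hgrow xs (x t) hxs (hx t ht.1) i (htri i) (by rw [hneg, hik]; exact hk.le)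
        (fun j => by rw [hneg, hneg, hik]; exact hdown j)
      rw [hneg, hik, hzero i, zero_sub] at h
      have := hrate t ht.1 i k _ hk.le h
      have e : v' i t = 1 / (x t i ^ 2 - 1) * (-T.coshCurvature Φ (x t) i / (2 * Real.pi)) := rfl
      change -v' i t - N * (Real.exp (-c * t) * -c) < 0
      rw [ek]
      linarith

theorem exists_ricciFlow_of_isZeroCurvatureMetric (hΦ : T.IsWeight Φ) {rstar : V → ℝ}
    (hstar : T.IsZeroCurvatureMetric Φ rstar) {r₀ : V → ℝ} (hr₀ : IsCirclePackingMetric r₀) :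
    ∃ r : ℝ → V → ℝ, r 0 = r₀ ∧ T.IsRicciFlowOn Φ (Set.Ici 0) r ∧
      (∀ (b : ℝ) (ρ : ℝ → V → ℝ), ρ 0 = r₀ → T.IsRicciFlowOn Φ (Set.Ico 0 b) ρ →
        Set.EqOn ρ r (Set.Ico 0 b)) ∧
      ∃ C > 0, ∃ c > 0, ∀ t ≥ 0, ∀ i, |r t i - rstar i| ≤ C * Real.exp (-c * t) := by
  obtain ⟨hpos, hzero⟩ := (isZeroCurvatureMetric_iff hΦ).mp hstar
  obtain ⟨m, M, N, lo, hm, hmM, hN, hmlo, hin, hx₀, hxs, hdist⟩ :=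
    exists_pointsInward_coshField hΦ (x₀ := fun i => Real.cosh (r₀ i))
      (fun i => Real.one_lt_cosh.mpr (hpos i).ne') hzero
      (fun i => Real.one_lt_cosh.mpr (hr₀ i).ne')
  have hbox : ∀ x ∈ Set.Icc lo (fun _ => M), ∀ i, x i ∈ Set.Icc m M := fun x hx i =>
    ⟨(hmlo i).trans (hx.1 i), hx.2 i⟩
  have hsmooth : ContDiffOn ℝ 1 (T.coshField Φ) (Set.Icc lo fun _ => M) := fun x hx =>
    (contDiffAt_coshField hΦ fun i => hm.trans_le (hbox x hx i).1).contDiffWithinAt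
  obtain ⟨K, hK⟩ := hsmooth.exists_lipschitzOnWith one_ne_zero (convex_Icc _ _) isCompact_Icc
  obtain ⟨x, hx0, hx⟩ := hin.exists_solution hK hx₀
  have hone : ∀ t ≥ 0, ∀ i, 1 < x t i := fun t ht i => hm.trans_le (hbox _ (hx t ht).1 i).1
  have hcosh : ∀ t ∈ Set.Ici (0 : ℝ), (fun i => Real.cosh (Real.arcosh (x t i))) = x t :=
    fun t ht => funext fun i => Real.cosh_arcosh (hone t ht i).le
  have hflow : T.IsRicciFlowOn Φ (Set.Ici 0) fun t i => Real.arcosh (x t i) := by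
    refine (isRicciFlowOn_iff hΦ).mpr fun t ht => ⟨fun i => Real.arcosh_pos (hone t ht i), ?_⟩
    rw [hcosh t ht]
    exact (hx t ht).2.congr hcosh (hcosh t ht)
  refine ⟨fun t i => Real.arcosh (x t i), ?_, hflow, ?_, ?_⟩
  · ext i
    simp [hx0, Real.arcosh_cosh (hr₀ i).le]
  · intro b ρ hρ0 hρ t ht
    have hρ' := (isRicciFlowOn_iff hΦ).mp hρ
    have heq := hin.eqOn_solutions hK (x := fun s i => Real.cosh (ρ s i)) (z := x)
      (fun s hs => (hρ' s hs).2) (fun s hs => (hx s hs.1).2.mono Set.Ico_subset_Ici_self)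
      (by simpa [hρ0] using hx₀) (by simp [hρ0, hx0]) ht
    ext i
    change ρ t i = Real.arcosh (x t i)
    rw [← heq, Real.arcosh_cosh ((hρ' t ht).1 i).le]
  · obtain ⟨c, hc, hcon⟩ := exists_exponential_contraction hΦ hzero hm hmM hN (hbox _ hxs)
      (fun t ht => hbox _ (hx t ht).1) (fun t ht => (hx t ht).2) (by simpa [hx0] using hdist)
    refine ⟨√(M ^ 2 - 1) * N, mul_pos (sqrt_sq_sub_one_pos (hm.trans_le hmM)) hN, c, hc,
      fun t ht i => ?_⟩
    have h := abs_arcosh_sub_arcosh_le (hone t ht i) (Real.one_lt_cosh.mpr (hpos i).ne')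
      (hbox _ (hx t ht).1 i).2 (hbox _ hxs i).2
    rw [Real.arcosh_cosh (hpos i).le] at h
    rw [mul_assoc]
    exact h.trans (mul_le_mul_of_nonneg_left (hcon t ht i) (Real.sqrt_nonneg _))

/-- The limit of a convergent flow has zero curvature. By the mean value theorem the velocity at some
time between `n` and `n + 1` is the increment over this interval, which tends to `0`. -/
theorem isZeroCurvatureMetric_of_tendsto (hΦ : T.IsWeight Φ) {r : ℝ → V → ℝ}
    (hr : T.IsRicciFlowOn Φ (Set.Ici 0) r) {r' : V → ℝ} (hr' : IsCirclePackingMetric r')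
    (hlim : Tendsto r atTop (𝓝 r')) : T.IsZeroCurvatureMetric Φ r' := by
  refine (isZeroCurvatureMetric_iff hΦ).mpr ⟨hr', fun i => ?_⟩
  have hflow := (isRicciFlowOn_iff hΦ).mp hr
  set x : ℝ → V → ℝ := fun t i => Real.cosh (r t i)
  set x' : V → ℝ := fun i => Real.cosh (r' i)
  have hx : Tendsto x atTop (𝓝 x') := tendsto_pi_nhds.mpr fun j =>
    (Real.continuous_cosh.tendsto _).comp (tendsto_pi_nhds.mp hlim j)
  have hF : Tendsto (fun t => T.coshField Φ (x t) i) atTop (𝓝 (T.coshField Φ x' i)) :=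
    (tendsto_pi_nhds.mp (contDiffAt_coshField hΦ
      fun j => Real.one_lt_cosh.mpr (hr' j).ne').continuousAt i).comp hx
  have hxi : Tendsto (fun t => x t i) atTop (𝓝 (x' i)) := tendsto_pi_nhds.mp hx i
  have hmvt : ∀ n : ℕ, ∃ ξ ∈ Set.Ioo (n : ℝ) (n + 1),
      T.coshField Φ (x ξ) i = x (n + 1) i - x n i := by
    intro n
    have hn : (0 : ℝ) ≤ n := Nat.cast_nonneg n
    have hd : ∀ t ≥ 0, HasDerivWithinAt (fun t => x t i) (T.coshField Φ (x t) i) (Set.Ici 0) t :=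
      fun t ht => hasDerivWithinAt_pi.mp (hflow t ht).2 i
    obtain ⟨ξ, hξ, h⟩ := exists_hasDerivAt_eq_slope (fun t => x t i)
      (fun t => T.coshField Φ (x t) i) (lt_add_one (n : ℝ))
      (fun t ht => (hd t (hn.trans ht.1)).continuousWithinAt.mono
        fun s hs => hn.trans hs.1)
      (fun t ht => (hd t (hn.trans ht.1.le)).hasDerivAt (Ici_mem_nhds (hn.trans_lt ht.1)))
    exact ⟨ξ, hξ, by simpa using h⟩
  choose ξ hξ hξeq using hmvt
  have hξlim : Tendsto ξ atTop atTop :=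
    tendsto_atTop_mono (fun n => (hξ n).1.le) tendsto_natCast_atTop_atTop
  have h1 : Tendsto (fun n => T.coshField Φ (x (ξ n)) i) atTop (𝓝 (T.coshField Φ x' i)) :=
    hF.comp hξlim
  have h2 : Tendsto (fun n : ℕ => x (n + 1) i - x n i) atTop (𝓝 0) := by
    have ha : Tendsto (fun n : ℕ => (n : ℝ) + 1) atTop atTop :=
      tendsto_atTop_add_const_right _ _ tendsto_natCast_atTop_atTop
    simpa using (hxi.comp ha).sub (hxi.comp tendsto_natCast_atTop_atTop)
  have h0 : T.coshField Φ x' i = 0 := tendsto_nhds_unique h1 (by simpa only [hξeq] using h2)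
  simpa [coshField, Real.pi_ne_zero] using h0

end SurfaceTriangulation

theorem mainTheorem1 {X : Type*} [TopologicalSpace X] [T2Space X] [CompactSpace X]
    [ChartedSpace (EuclideanSpace ℝ (Fin 2)) X]
    {V : Type*} [Fintype V] [DecidableEq V]
    (T : SurfaceTriangulation V X) (Φ : Sym2 V → ℝ) (hΦ : T.IsWeight Φ) :
    -- long time existence, uniqueness and exponential convergence of the flow
    (∀ rstar : V → ℝ, T.IsZeroCurvatureMetric Φ rstar →
      ∀ r₀ : V → ℝ, IsCirclePackingMetric r₀ →
        ∃ r : ℝ → V → ℝ, r 0 = r₀ ∧ T.IsRicciFlowOn Φ (Set.Ici 0) r ∧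
          (∀ (b : ℝ) (ρ : ℝ → V → ℝ), ρ 0 = r₀ → T.IsRicciFlowOn Φ (Set.Ico 0 b) ρ →
            Set.EqOn ρ r (Set.Ico 0 b)) ∧
          ∃ C > 0, ∃ c > 0, ∀ t ≥ 0, ∀ i, |r t i - rstar i| ≤ C * Real.exp (-c * t)) ∧
    -- convergence of the flow is equivalent to the existence of a zero curvature metric
    (∀ r₀ : V → ℝ, IsCirclePackingMetric r₀ →
      ((∃ r : ℝ → V → ℝ, r 0 = r₀ ∧ T.IsRicciFlowOn Φ (Set.Ici 0) r ∧
          ∃ r' : V → ℝ, IsCirclePackingMetric r' ∧ Tendsto r atTop (𝓝 r')) ↔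
        ∃ rstar : V → ℝ, T.IsZeroCurvatureMetric Φ rstar)) := by
  have converge : ∀ rstar : V → ℝ, T.IsZeroCurvatureMetric Φ rstar →
      ∀ r₀ : V → ℝ, IsCirclePackingMetric r₀ → _ := fun rstar hstar r₀ hr₀ =>
    SurfaceTriangulation.exists_ricciFlow_of_isZeroCurvatureMetric hΦ hstar hr₀
  refine ⟨converge, fun r₀ hr₀ => ⟨?_, ?_⟩⟩
  · rintro ⟨r, -, hr, r', hr', hlim⟩
    exact ⟨r', SurfaceTriangulation.isZeroCurvatureMetric_of_tendsto hΦ hr hr' hlim⟩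
  · rintro ⟨rstar, hstar⟩
    obtain ⟨r, hr0, hr, -, C, -, c, hc, hdecay⟩ := converge rstar hstar r₀ hr₀
    refine ⟨r, hr0, hr, rstar, hstar.1, tendsto_pi_nhds.mpr fun i => ?_⟩
    have hexp : Tendsto (fun t : ℝ => C * Real.exp (-c * t)) atTop (𝓝 0) := by
      have h : Tendsto (fun t : ℝ => -c * t) atTop atBot :=
        tendsto_id.const_mul_atTop_of_neg (neg_neg_of_pos hc)
      simpa using (Real.tendsto_exp_atBot.comp h).const_mul C
    refine tendsto_iff_dist_tendsto_zero.mpr (squeeze_zero' (Eventually.of_forall fun _ =>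
      dist_nonneg) ?_ hexp)
    filter_upwards [eventually_ge_atTop 0] with t ht
    exact hdecay t ht i
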